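/- Let $K,\ell\in\{2,3,4,\dots\}$. Let $G_1,G_2,\dots$ be graphs with finitely many edges on a common vertex set $\mathcal V$, each of girth at least $K+1$ (no cycles of length $\le K$; in particular the graphs are simple), and let $n_m$ be the number of edges of $G_m$; assume $n_m\to\infty$. Let $M_i$, $i\in\mathcal V$, be mutually independent random variables, each uniformly distributed over $\{1,\dots,\ell\}$. For an edge $e$ with endpoints $i,j$ put $D_e=1$ if $M_i=M_j$ and $D_e=0$ otherwise, and let $$\xi^*_m=\frac{\sum_{e\in E(G_m)}D_e-n_m\ell^{-1}}{\sqrt{n_m\ell^{-1}(1-\ell^{-1})}} .$$ Suppose that $\xi^*_m$ converges in law, as $m\to\infty$, to a probability distribution which is not normal (point masses count as normal here and below). Let $W$ be a real-valued random variable with expectation $\mu$ and variance $\sigma^2$, where $0<\sigma<\infty$. Then there exist random variables $X_1,X_2,\dots$ on a common probability space, each distributed as $W$, such that any $K$ of them with distinct indices are mutually independent, and such that the standardized partial sums $$S_n=\frac{1}{\sigma\sqrt n}\Bigl(\sum_{k=1}^nX_k-n\mu\Bigr)$$ do not converge in law to any normal distribution. Moreover, if in addition $E(G_1)\subseteq E(G_2)\subseteq\cdots$,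 $n_1<n_2<\cdots$ and $\lim_{m\to\infty}n_{m+1}/n_m=1$, then these $X_k$ can be chosen so that $S_n$ converges in law to a probability distribution which is not normal. -/

import Mathlib

open MeasureTheory ProbabilityTheory Filter Topology

/-- A family of real random variables is `K`-tuplewise independent if any `K` of them with
distinct indices are mutually independent. -/
def KTuplewiseIndep {ι Ω : Type*} [MeasurableSpace Ω] (K : ℕ) (X : ι → Ω → ℝ)
    (P : Measure Ω) : Prop :=
  ∀ i : Fin K → ι, Function.Injective i → iIndepFun (fun j => X (i j)) P

/-- A law on the real line is normal. The degenerate case (variance `0`, a point mass) counts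
as normal. -/
def IsNormalLaw (ν : Measure ℝ) : Prop :=
  ∃ (a : ℝ) (v : NNReal), ν = gaussianReal a v

/-- The standardized partial sum `(∑_{k < n} X_k - n μ) / (σ √n)`. -/
noncomputable def standardizedSum {Ω : Type*} (μ σ : ℝ) (X : ℕ → Ω → ℝ) (n : ℕ) (ω : Ω) : ℝ :=
  ((∑ k ∈ Finset.range n, X k ω) - n * μ) / (σ * √(n : ℝ))

/-- The indicator `D_e` of the event that the two endpoints of `e` carry the same label. -/
def edgeMatch {V Ω : Type*} {ℓ : ℕ} (M : V → Ω → Fin ℓ) (e : Sym2 V) (ω : Ω) : ℝ :=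
  if (e.map (fun i => M i ω)).IsDiag then 1 else 0

/-- The standardized number of edges of `G` whose endpoints carry the same label:
`(∑_{e ∈ E(G)} D_e - n ℓ⁻¹) / √(n ℓ⁻¹ (1 - ℓ⁻¹))`, where `n` is the number of edges. -/
noncomputable def xiStar {V Ω : Type*} {ℓ : ℕ} (G : SimpleGraph V) [Fintype G.edgeSet]
    (M : V → Ω → Fin ℓ) (ω : Ω) : ℝ :=
  ((∑ e ∈ G.edgeFinset, edgeMatch M e ω) - (G.edgeFinset.card : ℝ) * (ℓ : ℝ)⁻¹) /
    √((G.edgeFinset.card : ℝ) * (ℓ : ℝ)⁻¹ * (1 - (ℓ : ℝ)⁻¹))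

/-! The bits `D_e` are the source of the dependence. By the girth condition, at most `K` edges form
a forest. Such a forest has a leaf, whose label is uniform and independent of all the other labels;
so the leaf edge matches with probability `p = 1/ℓ` independently of the remaining edges. Peeling
off leaves shows that any `K` bits are independent, although the normalized bit count need not be
asymptotically normal. `IsLeafy` records just what the peeling needs, so that it also applies to
unions of edge sets.

To pass from bits to the law `w` of `W`, write `w` as a mixture of two laws with weights `p` and `1
- p` and means `μ + κ(1 - p)` and `μ - κp`, where `κ > 0` (`exists_mixture_decomposition`). Given
the bits, let `X_k` be drawn independently from the component chosen by the `k`-th bit. Then `X_k`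
has law `w`, and independence of any `K` bits passes to the corresponding `X_k`. Conditionally on
the bits, the sum has mean `nμ + κT_n`, where `T_n` is the centered bit count, and its fluctuation
about that mean is asymptotically Gaussian with a nonrandom variance. Hence `S_n` behaves like
`rξ_n` plus an independent centered Gaussian, with `ξ_n` the standardized bit count and `r ≠ 0`
(`tendsto_charFun_standardizedSum_mixVar`). A non-normal limit of `ξ_n` stays non-normal after this
convolution, because the Gaussian characteristic function can be divided out.

It remains to order the bits in a sequence. If the graphs are nested with edge ratios tending to
`1`, list the edges so that each `E(G_m)` is an initial segment; intermediate segments differ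
negligibly in `L²`. Otherwise use independent copies of a rapidly growing subsequence of the graphs:
the latest block then dominates everything before it, which gives a non-normal limit along a
subsequence and excludes a normal limit of the whole sequence. -/

/-! ### Leaves in small edge collections -/

/-- A set of edges is `K`-leafy if every nonempty collection of at most `K` of its edges has a
non-loop edge with an endpoint that lies on no other edge of the collection. -/
def IsLeafy {V : Type*} (K : ℕ) (E : Set (Sym2 V)) : Prop :=
  ∀ S : Finset (Sym2 V), ↑S ⊆ E → S.Nonempty → S.card ≤ K →
    ∃ v w, s(v, w) ∈ S ∧ v ≠ w ∧ ∀ f ∈ S, v ∈ f → f = s(v, w)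

/-- An acyclic graph with an edge and finitely
many edges has a leaf. -/
theorem SimpleGraph.IsAcyclic.exists_leaf {V : Type*} {H : SimpleGraph V} [Finite H.edgeSet]
    (hH : H.IsAcyclic) {a b : V} (hab : H.Adj a b) :
    ∃ v w, H.Adj v w ∧ ∀ x, H.Adj v x → x = w := by
  have : Nonempty V := ⟨a⟩
  -- The leaf is the initial vertex of a longest path: another neighbour would either extend the
  -- path or close a cycle.
  obtain ⟨u, v, p, hp, hmax⟩ := SimpleGraph.Walk.exists_isPath_forall_isPath_length_le_length H
  have hnil : ¬ p.Nil := by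
    intro h
    have h1 := hmax a b hab.toWalk (by simp [SimpleGraph.Walk.cons_isPath_iff, hab.ne])
    have h2 := SimpleGraph.Walk.length_eq_zero_iff.mpr h
    simp at h1
    omega
  refine ⟨u, _, p.adj_snd hnil, fun w hadj => ?_⟩
  apply hH.eq_snd_of_adj_start hp hadj
  have : ¬(p.cons hadj.symm).IsPath := by grind [SimpleGraph.Walk.length_cons]
  grind [hp.cons]

/-- A cycle formed by at most `K` edges would have length at most `K`, contrary to the girth; so
these edges form a forest, which has a leaf. -/
theorem SimpleGraph.isLeafy_edgeSet {V : Type*} {G : SimpleGraph V} {K : ℕ}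
    (hG : ((K + 1 : ℕ) : ℕ∞) ≤ G.egirth) : IsLeafy K G.edgeSet := by
  classical
  intro S hS hne hcard
  set H := SimpleGraph.fromEdgeSet (S : Set (Sym2 V)) with hHdef
  have hHS : H.edgeSet = S := by
    rw [hHdef, SimpleGraph.edgeSet_fromEdgeSet]
    ext e
    simp only [Set.mem_sdiff, Finset.mem_coe, and_iff_left_iff_imp]
    exact fun he => G.not_isDiag_of_mem_edgeSet (hS he)
  have hHG : H ≤ G := by
    rw [← SimpleGraph.edgeSet_subset_edgeSet, hHS]; exact hS
  have : Finite H.edgeSet := by rw [hHS]; exact S.finite_toSet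
  have hac : H.IsAcyclic := by
    intro x c hc
    have h1 : ((K + 1 : ℕ) : ℕ∞) ≤ ((c.mapLe hHG).length : ℕ∞) :=
      SimpleGraph.le_egirth.mp hG _ _ (hc.mapLe hHG)
    have h2 : c.length ≤ S.card := by
      rw [← SimpleGraph.Walk.length_edges, ← List.toFinset_card_of_nodup hc.edges_nodup]
      refine Finset.card_le_card fun e he => ?_
      have := c.edges_subset_edgeSet (List.mem_toFinset.mp he)
      rwa [hHS] at this
    have h3 : K + 1 ≤ c.length := by
      have := Nat.cast_le.mp h1
      rwa [SimpleGraph.Walk.length_mapLe] at this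
    omega
  have hadj : ∀ x y, H.Adj x y ↔ s(x, y) ∈ S := by
    intro x y
    rw [← SimpleGraph.mem_edgeSet, hHS, Finset.mem_coe]
  obtain ⟨e, he⟩ := hne
  induction e with | _ a b
  obtain ⟨v, w, hvw, huniq⟩ := hac.exists_leaf ((hadj a b).mpr he)
  refine ⟨v, w, (hadj v w).mp hvw, hvw.ne, fun f hf hvf => ?_⟩
  obtain ⟨x, rfl⟩ := Sym2.mem_iff_exists.mp hvf
  rw [huniq x ((hadj v x).mpr hf)]

/-! ### Tuplewise independence of the match bits -/

/-- The set of outcomes where both endpoints of an edge carry the same label. -/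
def sameLabel {V Ω : Type*} {ℓ : ℕ} (M : V → Ω → Fin ℓ) (e : Sym2 V) : Set Ω :=
  {ω | (e.map (fun i => M i ω)).IsDiag}

section Labels

variable {V Ω : Type*} [MeasurableSpace Ω] {P : Measure Ω} {ℓ : ℕ}
  {M : V → Ω → Fin ℓ}

theorem measurableSet_sameLabel (hM : ∀ i, Measurable (M i)) (e : Sym2 V) :
    MeasurableSet (sameLabel M e) := by
  induction e with | _ a b
  simpa [sameLabel] using measurableSet_eq_fun (hM a) (hM b)

/-- The label of a vertex coincides with probability `1/ℓ` with another label, independently of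
events determined by finitely many other vertices. -/
theorem measure_inter_sameLabel (hM : ∀ i, Measurable (M i)) (hind : iIndepFun M P)
    (hunif : ∀ i a, P {ω | M i ω = a} = (ℓ : ENNReal)⁻¹) (v w : V) (T : Finset V) (hv : v ∉ T)
    (hw : w ∈ T) (A : Set Ω)
    (hA : MeasurableSet[MeasurableSpace.comap (fun ω (i : T) => M i ω) inferInstance] A) :
    P (A ∩ sameLabel M s(v, w)) = (ℓ : ENNReal)⁻¹ * P A := by
  classical
  have hI : IndepFun (fun ω (i : ({v} : Finset V)) => M i ω) (fun ω (i : T) => M i ω) P :=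
    hind.indepFun_finset {v} T (by simpa using hv) hM
  have hA' : MeasurableSet A :=
    (measurable_pi_iff.mpr fun i : T => hM i).comap_le A hA
  -- Once the label of `w` is fixed to be `a`, matching means that `v` has label `a`, which is
  -- independent of everything on `T`.
  have key : ∀ a : Fin ℓ, P (A ∩ sameLabel M s(v, w) ∩ {ω | M w ω = a}) =
      (ℓ : ENNReal)⁻¹ * P (A ∩ {ω | M w ω = a}) := by
    intro a
    have h1 : A ∩ sameLabel M s(v, w) ∩ {ω | M w ω = a} =
        {ω | M v ω = a} ∩ (A ∩ {ω | M w ω = a}) := by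
      ext ω
      simp only [sameLabel, Set.mem_inter_iff, Set.mem_ofPred_eq, Sym2.map_mk, Sym2.mk_isDiag_iff]
      constructor
      · rintro ⟨⟨h, h'⟩, rfl⟩; exact ⟨h', h, rfl⟩
      · rintro ⟨h, h', h''⟩; exact ⟨⟨h', h.trans h''.symm⟩, h''⟩
    rw [h1, ← hunif v a]
    refine (IndepFun_iff _ _ _).mp hI _ _ ?_ ?_
    · exact ⟨{x | x ⟨v, by simp⟩ = a}, measurableSet_eq_fun (measurable_pi_apply _)
        measurable_const, rfl⟩
    · refine MeasurableSet.inter hA ?_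
      exact ⟨{x | x ⟨w, hw⟩ = a}, measurableSet_eq_fun (measurable_pi_apply _)
        measurable_const, rfl⟩
  have hmw : ∀ a, MeasurableSet {ω | M w ω = a} := fun a =>
    measurableSet_eq_fun (hM w) measurable_const
  have part : ∀ B : Set Ω, MeasurableSet B → P B = ∑ a, P (B ∩ {ω | M w ω = a}) := by
    intro B hB
    rw [← measure_biUnion_finset (f := fun a => B ∩ {ω | M w ω = a}) _ fun a _ => hB.inter (hmw a)]
    · congr 1
      ext ω; simp
    · intro a _ b _ hab
      refine Set.disjoint_left.mpr fun ω h h' => hab ?_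
      exact h.2.symm.trans h'.2
  rw [part _ (hA'.inter (measurableSet_sameLabel hM _)), part A hA', Finset.mul_sum]
  exact Finset.sum_congr rfl fun a _ => key a

variable [IsProbabilityMeasure P]

/-- Induction on the number of edges: removing a leaf edge contributes a factor `1/ℓ`, since its
leaf meets none of the other edges. -/
theorem measure_iInter_sameLabel (hM : ∀ i, Measurable (M i)) (hind : iIndepFun M P)
    (hunif : ∀ i a, P {ω | M i ω = a} = (ℓ : ENNReal)⁻¹) {K : ℕ} {E : Set (Sym2 V)}
    (hE : IsLeafy K E) (S : Finset (Sym2 V)) (hS : ↑S ⊆ E) (hcard : S.card ≤ K) :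
    P (⋂ e ∈ S, sameLabel M e) = ((ℓ : ENNReal)⁻¹) ^ S.card := by
  classical
  induction hn : S.card generalizing S with
  | zero => simp [Finset.card_eq_zero.mp hn]
  | succ n ih =>
    obtain ⟨v, w, he, hvw, huniq⟩ := hE S hS (Finset.card_pos.mp (by omega)) hcard
    set S' := S.erase s(v, w) with hS'
    have hcard' : S'.card = n := by rw [hS', Finset.card_erase_of_mem he]; omega
    have hIH := ih S' (fun e h => hS (Finset.mem_of_mem_erase h)) (by omega) hcard'
    have hsplit : (⋂ e ∈ S, sameLabel M e) = (⋂ e ∈ S', sameLabel M e) ∩ sameLabel M s(v, w) := by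
      rw [← Finset.insert_erase he, Finset.set_biInter_insert, Set.inter_comm]
    set T : Finset V := insert w (S'.biUnion Sym2.toFinset) with hT
    have hvT : v ∉ T := by
      simp only [hT, Finset.mem_insert, Finset.mem_biUnion, not_or, Sym2.mem_toFinset]
      refine ⟨hvw, ?_⟩
      rintro ⟨f, hf, hvf⟩
      exact (Finset.mem_erase.mp hf).1 (huniq f (Finset.mem_of_mem_erase hf) hvf)
    rw [hsplit, measure_inter_sameLabel hM hind hunif v w T hvT (by simp [hT]), hIH, pow_succ']
    refine Finset.measurableSet_biInter _ fun e heS => ?_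
    have hsub : ∀ x ∈ e, x ∈ T := fun x hx => by
      simp only [hT, Finset.mem_insert, Finset.mem_biUnion, Sym2.mem_toFinset]
      exact Or.inr ⟨e, heS, hx⟩
    induction e with | _ a b
    exact ⟨{x | x ⟨a, hsub a (by simp)⟩ = x ⟨b, hsub b (by simp)⟩},
      measurableSet_eq_fun (measurable_pi_apply _) (measurable_pi_apply _), by
        ext ω; simp [sameLabel]⟩

open Classical in
/-- Whether both endpoints of an edge carry the same label. -/
noncomputable def matchBit {V Ω : Type*} {ℓ : ℕ} (M : V → Ω → Fin ℓ) (e : Sym2 V) (ω : Ω) : Bool :=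
  decide (ω ∈ sameLabel M e)

theorem edgeMatch_eq_matchBit {V Ω : Type*} {ℓ : ℕ} (M : V → Ω → Fin ℓ) (e : Sym2 V) (ω : Ω) :
    edgeMatch M e ω = if matchBit M e ω then 1 else 0 := by
  by_cases h : (e.map (fun i => M i ω)).IsDiag <;> simp [edgeMatch, matchBit, sameLabel, h]

theorem measurable_matchBit (hM : ∀ i, Measurable (M i)) (e : Sym2 V) :
    Measurable (matchBit M e) := by
  refine measurable_to_bool ?_
  have : matchBit M e ⁻¹' {true} = sameLabel M e := by ext ω; simp [matchBit]
  rw [this]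
  exact measurableSet_sameLabel hM e

theorem iIndepFun_matchBit (hM : ∀ i, Measurable (M i)) (hind : iIndepFun M P)
    (hunif : ∀ i a, P {ω | M i ω = a} = (ℓ : ENNReal)⁻¹) {K : ℕ} {E : Set (Sym2 V)} (hK : 1 ≤ K)
    (hE : IsLeafy K E) (g : Fin K → Sym2 V) (hg : Function.Injective g) (hgE : ∀ j, g j ∈ E) :
    iIndepFun (fun j => matchBit M (g j)) P := by
  classical
  have hset : iIndepSet (fun j => sameLabel M (g j)) P := by
    rw [iIndepSet_iff_meas_biInter fun j => measurableSet_sameLabel hM _]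
    intro s
    have h1 : (⋂ j ∈ s, sameLabel M (g j)) = ⋂ e ∈ s.image g, sameLabel M e := by
      simp
    have hsub : ∀ s : Finset (Fin K), ↑(s.image g) ⊆ E := by
      intro s e he
      obtain ⟨j, -, rfl⟩ := Finset.mem_image.mp (Finset.mem_coe.mp he)
      exact hgE j
    have h2 : ∀ j, P (sameLabel M (g j)) = (ℓ : ENNReal)⁻¹ := by
      intro j
      simpa using measure_iInter_sameLabel hM hind hunif hE {g j} (by simpa using hgE j)
        (by simpa using hK)
    rw [h1, measure_iInter_sameLabel hM hind hunif hE _ (hsub s)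
      (Finset.card_image_le.trans (by simpa using s.card_le_univ)),
      Finset.card_image_of_injective _ hg]
    simp [h2]
  have h := hset.iIndepFun_indicator (β := ℕ) |>.comp (fun _ x => decide (x = 1))
    fun _ => measurable_from_top
  convert h using 2 with j
  ext ω
  by_cases hω : ω ∈ sameLabel M (g j) <;> simp [matchBit, hω]

theorem measure_matchBit (hM : ∀ i, Measurable (M i)) (hind : iIndepFun M P)
    (hunif : ∀ i a, P {ω | M i ω = a} = (ℓ : ENNReal)⁻¹) {K : ℕ} {E : Set (Sym2 V)} (hK : 1 ≤ K)
    (hE : IsLeafy K E) {e : Sym2 V} (he : e ∈ E) :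
    P.real {ω | matchBit M e ω = true} = (ℓ : ℝ)⁻¹ := by
  have h : {ω | matchBit M e ω = true} = sameLabel M e := by ext ω; simp [matchBit]
  have h2 := measure_iInter_sameLabel hM hind hunif hE {e} (by simpa using he) (by simpa using hK)
  rw [h, Measure.real, show P (sameLabel M e) = (ℓ : ENNReal)⁻¹ by simpa using h2]
  simp

end Labels

/-! ### Leafiness across disjoint copies -/

/-- Disjoint copies of leafy sets of edges form a leafy set. -/
theorem IsLeafy.iUnion_copies {V : Type*} {K : ℕ} {E : ℕ → Set (Sym2 V)}
    (hE : ∀ j, IsLeafy K (E j)) :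
    IsLeafy K (⋃ j, Sym2.map (Prod.mk j) '' E j) := by
  classical
  intro S hS hne hcard
  obtain ⟨e, he⟩ := hne
  obtain ⟨j, hj⟩ := Set.mem_iUnion.mp (hS he)
  have hinj : Function.Injective (Sym2.map (Prod.mk j) : Sym2 V → Sym2 (ℕ × V)) :=
    Sym2.map.injective (Prod.mk_right_injective j)
  obtain ⟨e₀, he₀, rfl⟩ := hj
  have back : ∀ f ∈ S, ∀ v, (j, v) ∈ f → ∃ f₀ ∈ E j, Sym2.map (Prod.mk j) f₀ = f := by
    intro f hf v hv
    obtain ⟨i, f₀, hf₀, rfl⟩ := Set.mem_iUnion.mp (hS hf)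
    obtain ⟨x, -, hx⟩ := Sym2.mem_map.mp hv
    obtain rfl : i = j := congrArg Prod.fst hx
    exact ⟨f₀, hf₀, rfl⟩
  -- It suffices to find a leaf in the part of `S` inside the `j`-th copy, as edges of other copies
  -- avoid its vertices.
  set S₀ := S.preimage (Sym2.map (Prod.mk j)) hinj.injOn with hS₀
  have hS₀E : ↑S₀ ⊆ E j := by
    intro f hf
    have hf' : Sym2.map (Prod.mk j) f ∈ S := by simpa [hS₀] using hf
    induction f with | _ a b
    obtain ⟨f₀, hf₀, hff⟩ := back _ hf' a (by simp)
    rwa [← hinj hff]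
  obtain ⟨v, w, hvw, hne, huniq⟩ := hE j S₀ hS₀E ⟨e₀, by simpa [hS₀] using he⟩
    ((Finset.card_le_card_of_injOn _ (fun f hf => by simpa [hS₀] using hf) hinj.injOn).trans hcard)
  refine ⟨(j, v), (j, w), by simpa [hS₀] using hvw, by simpa using hne, fun f hf hvf => ?_⟩
  obtain ⟨f₀, hf₀, rfl⟩ := back f hf v hvf
  have : v ∈ f₀ := by
    obtain ⟨x, hx, hxv⟩ := Sym2.mem_map.mp hvf
    obtain rfl : x = v := congrArg Prod.snd hxv
    exact hx
  rw [huniq f₀ (by simpa [hS₀] using hf) this]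
  simp

/-! ### Splitting a law into two components -/

/-- The numerical value of a bit. -/
def bitVal (β : Bool) : ℝ := if β then 1 else 0

@[simp] theorem bitVal_true : bitVal true = 1 := rfl

@[simp] theorem bitVal_false : bitVal false = 0 := by simp [bitVal]

theorem measurable_bitVal : Measurable bitVal := measurable_from_top

theorem integral_withDensity_ofReal {w : Measure ℝ} {f : ℝ → ℝ} (hf : Measurable f) (hf0 : ∀ x, 0 ≤ f x)
    {E : Type*} [NormedAddCommGroup E] [NormedSpace ℝ E] (g : ℝ → E) :
    ∫ x, g x ∂(w.withDensity fun x => ENNReal.ofReal (f x)) = ∫ x, f x • g x ∂w := by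
  rw [integral_withDensity_eq_integral_toReal_smul (by fun_prop) (by simp)]
  simp [hf0]

theorem isProbabilityMeasure_withDensity_ofReal {w : Measure ℝ} {f : ℝ → ℝ} (hint : Integrable f w)
    (hf0 : ∀ x, 0 ≤ f x) (hf1 : ∫ x, f x ∂w = 1) :
    IsProbabilityMeasure (w.withDensity fun x => ENNReal.ofReal (f x)) := by
  refine ⟨?_⟩
  rw [withDensity_apply _ MeasurableSet.univ, Measure.restrict_univ,
    ← ofReal_integral_eq_lintegral_ofReal hint (ae_of_all _ hf0), hf1, ENNReal.ofReal_one]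

section Split

variable {w : Measure ℝ} [IsProbabilityMeasure w]

/-- The tail indicator at the mean is positively correlated with a nondegenerate variable. -/
theorem setIntegral_Ioi_sub_mean_pos (hw : MemLp id 2 w) {μ : ℝ} (hμ : ∫ x, x ∂w = μ)
    (hvar : 0 < Var[id; w]) : 0 < ∫ x in Set.Ioi μ, (x - μ) ∂w := by
  have hint : Integrable (fun x : ℝ => x - μ) w :=
    (hw.integrable (by norm_num)).sub (integrable_const μ)
  have hnn : 0 ≤ᵐ[w.restrict (Set.Ioi μ)] fun x => x - μ := by
    refine (ae_restrict_iff' measurableSet_Ioi).mpr (ae_of_all _ fun x hx => ?_)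
    exact sub_nonneg.mpr (le_of_lt hx)
  refine lt_of_le_of_ne (integral_nonneg_of_ae hnn) fun h0 => ?_
  -- The deviations above and below the mean balance, so if one side vanishes then so does the
  -- other, and the law is a point mass.
  have h1 : ∫ x in Set.Iic μ, (μ - x) ∂w = 0 := by
    have htot : ∫ x, (x - μ) ∂w = 0 := by
      have hid : Integrable (fun x : ℝ => x) w := hw.integrable (by norm_num)
      rw [integral_sub hid (integrable_const μ)]
      simp [hμ]
    have := integral_add_compl (μ := w) (measurableSet_Ioi (a := μ)) hint
    rw [← h0, htot, Set.compl_Ioi, zero_add] at this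
    calc ∫ x in Set.Iic μ, (μ - x) ∂w = - ∫ x in Set.Iic μ, (x - μ) ∂w := by
          rw [← integral_neg]; simp
      _ = 0 := by rw [this, neg_zero]
  have hnn' : 0 ≤ᵐ[w.restrict (Set.Iic μ)] fun x => μ - x := by
    refine (ae_restrict_iff' measurableSet_Iic).mpr (ae_of_all _ fun x hx => ?_)
    exact sub_nonneg.mpr hx
  have ha := (integral_eq_zero_iff_of_nonneg_ae hnn hint.integrableOn).mp h0.symm
  have hb := (integral_eq_zero_iff_of_nonneg_ae hnn'
    (((integrable_const μ).sub (hw.integrable (by norm_num))).integrableOn)).mp h1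
  have ha' := (ae_restrict_iff' measurableSet_Ioi).mp ha
  have hb' := (ae_restrict_iff' measurableSet_Iic).mp hb
  have hae : (id : ℝ → ℝ) =ᵐ[w] fun _ => μ := by
    filter_upwards [ha', hb'] with x h h'
    rcases lt_or_ge μ x with hx | hx
    · have := h hx; simp only [Pi.zero_apply] at this; simp only [id]; linarith
    · have := h' hx; simp only [Pi.zero_apply] at this; simp only [id]; linarith
  rw [variance_congr hae, variance_eq_integral (by fun_prop)] at hvar
  simp at hvar

/-- A nondegenerate law with finite variance is a mixture with weights `p` and `1 - p` of two laws
with different means. -/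
theorem exists_mixture_decomposition (hw : MemLp id 2 w) {μ : ℝ} (hμ : ∫ x, x ∂w = μ)
    (hvar : 0 < Var[id; w]) {p : ℝ} (hp0 : 0 < p) (hp1 : p < 1) :
    ∃ ν : Bool → Measure ℝ, (∀ β, IsProbabilityMeasure (ν β)) ∧ (∀ β, MemLp id 2 (ν β)) ∧
      (∀ t, p * charFun (ν true) t + (1 - p) * charFun (ν false) t = charFun w t) ∧
      ∃ κ : ℝ, 0 < κ ∧ ∀ β, ∫ x, x ∂(ν β) = μ + κ * (bitVal β - p) := by
  set π : ℝ := w.real (Set.Ioi μ) with hπ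
  have hπ0 : 0 ≤ π := measureReal_nonneg
  have hπ1 : π ≤ 1 := measureReal_le_one
  set h : ℝ → ℝ := fun x => (Set.Ioi μ).indicator 1 x - π with hh
  have hmeas : Measurable h :=
    (measurable_one.indicator measurableSet_Ioi).sub measurable_const
  have hbd : ∀ x, -1 ≤ h x ∧ h x ≤ 1 := by
    intro x
    by_cases hx : x ∈ Set.Ioi μ <;> simp only [hh, hx, Set.indicator_of_mem,
      Set.indicator_of_notMem, not_false_eq_true, Pi.one_apply] <;> constructor <;> linarith
  have hint : Integrable h w :=
    ((integrable_const (1 : ℝ)).indicator measurableSet_Ioi).sub (integrable_const π)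
  have hint0 : ∫ x, h x ∂w = 0 := by
    have hi : Integrable ((Set.Ioi μ).indicator (1 : ℝ → ℝ)) w :=
      (integrable_const (1 : ℝ)).indicator measurableSet_Ioi
    rw [integral_sub hi (integrable_const π), integral_indicator_one measurableSet_Ioi]
    simp [hπ]
  have hb : ∀ β : Bool, -1 ≤ bitVal β - p ∧ bitVal β - p ≤ 1 := by
    intro β; cases β <;> simp <;> constructor <;> linarith
  -- The densities of the two components relative to `w`. Their weighted average is `1` because
  -- `bitVal β - p` averages to `0`; each integrates to `1` because `h` is centered; and `|h| ≤ 1`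
  -- keeps them in `[0, 2]`. The correlation of `h` with `x` produces the difference of means.
  set f : Bool → ℝ → ℝ := fun β x => 1 + (bitVal β - p) * h x with hf
  have hfm : ∀ β, Measurable (f β) := fun β => by fun_prop
  have hf0 : ∀ β x, 0 ≤ f β x := by
    intro β x
    have := abs_le.mpr (hb β)
    have := abs_le.mpr (hbd x)
    have h3 : |(bitVal β - p) * h x| ≤ 1 := by
      rw [abs_mul]; exact mul_le_one₀ ‹_› (abs_nonneg _) ‹_›
    have := (abs_le.mp h3).1
    simp only [hf]; linarith
  have hf2 : ∀ β x, f β x ≤ 2 := by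
    intro β x
    have := abs_le.mpr (hb β)
    have := abs_le.mpr (hbd x)
    have h3 : |(bitVal β - p) * h x| ≤ 1 := by
      rw [abs_mul]; exact mul_le_one₀ ‹_› (abs_nonneg _) ‹_›
    have := (abs_le.mp h3).2
    simp only [hf]; linarith
  have hfint : ∀ β, Integrable (f β) w := fun β =>
    (integrable_const 1).add (hint.const_mul _)
  have hf1 : ∀ β, ∫ x, f β x ∂w = 1 := by
    intro β
    rw [integral_add (integrable_const 1) (hint.const_mul _), integral_const_mul, hint0]
    simp
  have hid : Integrable (fun x : ℝ => x) w := hw.integrable (by norm_num)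
  have hhid : Integrable (fun x : ℝ => h x * x) w :=
    hid.bdd_mul (c := 1) hmeas.aestronglyMeasurable
      (ae_of_all _ fun x => by simpa [abs_le] using hbd x)
  refine ⟨fun β => w.withDensity fun x => ENNReal.ofReal (f β x), fun β =>
    isProbabilityMeasure_withDensity_ofReal (hfint β) (hf0 β) (hf1 β), fun β => ?_, fun t => ?_,
    ∫ x in Set.Ioi μ, (x - μ) ∂w, setIntegral_Ioi_sub_mean_pos hw hμ hvar, fun β => ?_⟩
  · refine MemLp.of_measure_le_smul (c := 2) (by norm_num) ?_ hw
    refine Measure.le_iff.mpr fun s hs => ?_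
    rw [withDensity_apply _ hs, Measure.smul_apply, smul_eq_mul, ← setLIntegral_const]
    refine lintegral_mono fun x => ?_
    rw [← ENNReal.ofReal_ofNat]
    exact ENNReal.ofReal_le_ofReal (hf2 β x)
  · simp only [charFun_apply_real]
    rw [integral_withDensity_ofReal (hfm _) (hf0 _), integral_withDensity_ofReal (hfm _) (hf0 _)]
    have hI : ∀ β, Integrable (fun x : ℝ => f β x • Complex.exp (t * x * Complex.I)) w := by
      intro β
      have : Integrable (fun x : ℝ => Complex.exp (t * x * Complex.I) * ((f β x : ℝ) : ℂ)) w := by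
        refine (hfint β).ofReal.bdd_mul (c := 1) (by fun_prop) (ae_of_all _ fun x => ?_)
        rw [← Complex.ofReal_mul, Complex.norm_exp_ofReal_mul_I]
      simpa [mul_comm] using this
    rw [← integral_const_mul, ← integral_const_mul, ← integral_add ((hI _).const_mul _)
      ((hI _).const_mul _)]
    refine integral_congr_ae (ae_of_all _ fun x => ?_)
    simp only [hf, bitVal_true, bitVal_false, Complex.real_smul]
    push_cast
    ring
  · rw [integral_withDensity_ofReal (hfm _) (hf0 _)]
    have h1 : ∀ x, f β x • x = x + (bitVal β - p) * (h x * x) := by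
      intro x; simp only [hf, smul_eq_mul]; ring
    simp_rw [h1]
    rw [integral_add hid (hhid.const_mul _), integral_const_mul, hμ]
    have h2 : ∫ x, h x * x ∂w = ∫ x in Set.Ioi μ, (x - μ) ∂w := by
      have : ∀ x, h x * x = (Set.Ioi μ).indicator (fun x => x - μ) x + (h x * μ + π * (μ - x)) := by
        intro x
        by_cases hx : x ∈ Set.Ioi μ <;> simp only [hh, hx, Set.indicator_of_mem,
          Set.indicator_of_notMem, not_false_eq_true, Pi.one_apply] <;> ring
      simp_rw [this]
      rw [integral_add, integral_add, integral_indicator measurableSet_Ioi, integral_mul_const,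
        hint0, integral_const_mul, integral_sub (integrable_const μ) hid, hμ]
      · simp
      · exact hint.mul_const _
      · exact ((integrable_const μ).sub hid).const_mul _
      · exact (hid.sub (integrable_const μ)).indicator measurableSet_Ioi
      · exact (hint.mul_const _).add (((integrable_const μ).sub hid).const_mul _)
    rw [h2]; ring

end Split

/-! ### Variables selected by bits -/

section Mixture

/-- The law of a random bit sequence together with independent draws from `ν β` for every index
and every bit `β`. -/
noncomputable def mixMeasure (Q : Measure (ℕ → Bool)) (ν : Bool → Measure ℝ)
    [∀ β, IsProbabilityMeasure (ν β)] : Measure ((ℕ → Bool) × (ℕ × Bool → ℝ)) :=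
  Q.prod (Measure.infinitePi fun i : ℕ × Bool => ν i.2)

/-- The draw selected by the `k`-th bit. -/
def mixVar (k : ℕ) (ω : (ℕ → Bool) × (ℕ × Bool → ℝ)) : ℝ := ω.2 (k, ω.1 k)

theorem measurable_mixVar (k : ℕ) : Measurable (mixVar k) := by
  have : mixVar k = fun ω => if ω.1 k = true then ω.2 (k, true) else ω.2 (k, false) := by
    ext ω
    cases h : ω.1 k <;> simp [mixVar, h]
  rw [this]
  refine Measurable.ite (measurableSet_eq_fun ?_ measurable_const) ?_ ?_ <;> fun_prop

variable (Q : Measure (ℕ → Bool)) [IsProbabilityMeasure Q] (ν : Bool → Measure ℝ)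
  [∀ β, IsProbabilityMeasure (ν β)]

instance : IsProbabilityMeasure (mixMeasure Q ν) := by
  unfold mixMeasure; infer_instance

/-- For fixed bits, distinct indices select distinct coordinates of the product measure, so the
draws are independent and the inner integral factorizes. -/
theorem integral_prod_mixVar {ι : Type*} [Fintype ι] (i : ι → ℕ) (hi : Function.Injective i)
    (g : ι → ℝ → ℂ) (hg : ∀ j, Measurable (g j)) (hg1 : ∀ j x, ‖g j x‖ ≤ 1) :
    ∫ ω, ∏ j, g j (mixVar (i j) ω) ∂(mixMeasure Q ν) =
      ∫ b, ∏ j, ∫ x, g j x ∂(ν (b (i j))) ∂Q := by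
  have hint : Integrable (fun ω => ∏ j, g j (mixVar (i j) ω)) (mixMeasure Q ν) := by
    refine Integrable.of_bound (C := 1) ?_ (ae_of_all _ fun ω => ?_)
    · exact (Finset.measurable_prod _ fun j _ =>
        (hg j).comp (measurable_mixVar (i j))).aestronglyMeasurable
    · rw [norm_prod]
      exact Finset.prod_le_one (fun _ _ => norm_nonneg _) fun j _ => hg1 j _
  unfold mixMeasure at hint ⊢
  rw [integral_prod _ hint]
  refine integral_congr_ae (ae_of_all _ fun b => ?_)
  have hind : iIndepFun (fun (j : ι) (y : ℕ × Bool → ℝ) => y (i j, b (i j)))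
      (Measure.infinitePi fun i : ℕ × Bool => ν i.2) := by
    refine (iIndepFun_infinitePi (P := fun i : ℕ × Bool => ν i.2) (X := fun _ x => x)
      fun _ => measurable_id).precomp (g := fun j => (i j, b (i j))) ?_
    intro j j' h
    exact hi (congrArg Prod.fst h)
  have h := hind.integral_fun_prod_comp (f := g)
    (fun j => (measurable_pi_apply _).aemeasurable)
    fun j => (hg j).aestronglyMeasurable
  simp only [mixVar]
  rw [h]
  refine Finset.prod_congr rfl fun j _ => ?_
  rw [← Measure.infinitePi_map_eval (fun i : ℕ × Bool => ν i.2) (i j, b (i j)),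
    integral_map (measurable_pi_apply _).aemeasurable (hg j).aestronglyMeasurable]

theorem integral_cexp_sum_mixVar {ι : Type*} [Fintype ι] (i : ι → ℕ) (hi : Function.Injective i)
    (t : ι → ℝ) :
    ∫ ω, Complex.exp ((∑ j, t j * mixVar (i j) ω : ℝ) * Complex.I) ∂(mixMeasure Q ν) =
      ∫ b, ∏ j, charFun (ν (b (i j))) (t j) ∂Q := by
  have h := integral_prod_mixVar Q ν i hi (fun j x => Complex.exp (t j * x * Complex.I))
    (fun j => by fun_prop) fun j x => by
      rw [← Complex.ofReal_mul, Complex.norm_exp_ofReal_mul_I]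
  simp only [charFun_apply_real]
  rw [← h]
  refine integral_congr_ae (ae_of_all _ fun ω => ?_)
  simp only
  rw [← Complex.exp_sum, ← Finset.sum_mul]
  push_cast
  rfl

/-- Averages of a function of a single bit. -/
theorem integral_comp_bit {k : ℕ} {p : ℝ} (hp : Q.real {b | b k = true} = p) (F : Bool → ℂ) :
    ∫ b, F (b k) ∂Q = p * F true + (1 - p) * F false := by
  have hm : Measurable fun b : ℕ → Bool => b k := measurable_pi_apply k
  have hs : MeasurableSet {b : ℕ → Bool | b k = true} := measurableSet_eq_fun hm measurable_const
  have hf : ∀ b : ℕ → Bool, F (b k) =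
      {b : ℕ → Bool | b k = true}.indicator (fun _ => F true - F false) b + F false := by
    intro b
    cases h : b k <;> simp [Set.indicator, h]
  simp_rw [hf]
  rw [integral_add ((integrable_const _).indicator hs) (integrable_const _),
    integral_indicator hs, setIntegral_const, hp]
  simp
  ring

variable {p : ℝ} (hp : ∀ k, Q.real {b | b k = true} = p)
include hp

theorem charFun_map_mixVar (k : ℕ) (t : ℝ) :
    charFun ((mixMeasure Q ν).map (mixVar k)) t =
      p * charFun (ν true) t + (1 - p) * charFun (ν false) t := by
  have h := integral_cexp_sum_mixVar Q ν (fun _ : Unit => k) (Function.injective_of_subsingleton _)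
    fun _ => t
  rw [charFun_apply_real, integral_map (measurable_mixVar k).aemeasurable (by fun_prop)]
  simp only [Finset.univ_unique, Finset.sum_singleton, Finset.prod_singleton] at h
  push_cast at h
  rw [h]
  exact integral_comp_bit Q (hp k) fun β => charFun (ν β) t

theorem map_mixVar {w : Measure ℝ} [IsProbabilityMeasure w]
    (hw : ∀ t, p * charFun (ν true) t + (1 - p) * charFun (ν false) t = charFun w t) (k : ℕ) :
    (mixMeasure Q ν).map (mixVar k) = w := by
  have := Measure.isProbabilityMeasure_map (μ := mixMeasure Q ν) (measurable_mixVar k).aemeasurable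
  refine Measure.ext_of_charFun (funext fun t => ?_)
  rw [charFun_map_mixVar Q ν hp, hw]

/-- The joint characteristic function is the mean of a product of functions of single bits;
independence of the bits splits it into the marginal characteristic functions. -/
theorem kTuplewiseIndep_mixVar {K : ℕ}
    (hind : ∀ i : Fin K → ℕ, Function.Injective i → iIndepFun (fun j (b : ℕ → Bool) => b (i j)) Q) :
    KTuplewiseIndep K mixVar (mixMeasure Q ν) := by
  intro i hi
  have hm : ∀ j, AEMeasurable (mixVar (i j)) (mixMeasure Q ν) :=
    fun j => (measurable_mixVar _).aemeasurable
  rw [iIndepFun_iff_charFun_pi hm]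
  intro t
  have h1 := integral_cexp_sum_mixVar Q ν i hi t
  rw [charFun_apply, integral_map _ (by fun_prop)]
  · simp only [PiLp.inner_apply, charFun_map_mixVar Q ν hp]
    have h2 := (hind i hi).integral_fun_prod_comp (f := fun j β => charFun (ν β) (t j))
      (fun j => (measurable_pi_apply _).aemeasurable) fun j => measurable_from_top.aestronglyMeasurable
    rw [h2] at h1
    have h3 : ∀ j, ∫ b, charFun (ν (b (i j))) (t j) ∂Q =
        p * charFun (ν true) (t j) + (1 - p) * charFun (ν false) (t j) :=
      fun j => integral_comp_bit Q (hp _) fun β => charFun (ν β) (t j)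
    simp only [h3] at h1
    rw [← h1]
    simp
  · exact (WithLp.measurable_toLp 2 _).comp_aemeasurable (aemeasurable_pi_lambda _ hm)

end Mixture

/-! ### Second moments of bit counts -/

section Bits

variable {ι Ω : Type*}

/-- The centered number of bits that are set, over a finite set of indices. -/
noncomputable def bitSum (p : ℝ) (B : ι → Ω → Bool) (A : Finset ι) (ω : Ω) : ℝ :=
  ∑ a ∈ A, (bitVal (B a ω) - p)

/-- The standardized number of bits that are set, over a finite set of indices. -/
noncomputable def bitXi (p : ℝ) (B : ι → Ω → Bool) (A : Finset ι) (ω : Ω) : ℝ :=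
  bitSum p B A ω / √(A.card * (p * (1 - p)))

variable [MeasurableSpace Ω] {P : Measure Ω} {p : ℝ} {B : ι → Ω → Bool}

@[fun_prop]
theorem measurable_bitSum (hB : ∀ a, Measurable (B a)) (A : Finset ι) :
    Measurable (bitSum p B A) :=
  Finset.measurable_fun_sum A fun a _ => (measurable_bitVal.comp (hB a)).sub_const p

theorem measurable_bitXi (hB : ∀ a, Measurable (B a)) (A : Finset ι) :
    Measurable (bitXi p B A) :=
  (measurable_bitSum hB A).div_const _

theorem norm_bitVal_le (β : Bool) : ‖bitVal β‖ ≤ 1 := by cases β <;> simp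

variable [IsProbabilityMeasure P]

theorem memLp_bit (hB : ∀ a, Measurable (B a)) (a : ι) :
    MemLp (fun ω => bitVal (B a ω) - p) 2 P :=
  (MemLp.of_bound (measurable_bitVal.comp (hB a)).aestronglyMeasurable 1
    (ae_of_all _ fun ω => norm_bitVal_le (B a ω))).sub (memLp_const p)

theorem memLp_bitSum (hB : ∀ a, Measurable (B a)) (A : Finset ι) : MemLp (bitSum p B A) 2 P :=
  memLp_finsetSum A fun a _ => memLp_bit hB a

theorem memLp_bitXi (hB : ∀ a, Measurable (B a)) (A : Finset ι) : MemLp (bitXi p B A) 2 P := by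
  have := (memLp_bitSum (P := P) (p := p) hB A).const_mul (√(A.card * (p * (1 - p))))⁻¹
  refine this.congr_norm (measurable_bitXi hB A).aestronglyMeasurable (ae_of_all _ fun ω => ?_)
  rw [bitXi, div_eq_inv_mul]

theorem integral_abs_le_sqrt {f : Ω → ℝ} (hf : MemLp f 2 P) :
    ∫ ω, |f ω| ∂P ≤ √(∫ ω, f ω * f ω ∂P) := by
  -- The Cauchy–Schwarz bound, read off from the nonnegative variance of `|f|`.
  have h := variance_nonneg (fun ω => |f ω|) P
  have hf' : MemLp (fun ω => |f ω|) 2 P := hf.abs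
  rw [variance_eq_sub hf'] at h
  refine Real.le_sqrt_of_sq_le ?_
  have h2 : ∫ ω, ((fun ω => |f ω|) ^ 2) ω ∂P = ∫ ω, f ω * f ω ∂P := by
    refine integral_congr_ae (ae_of_all _ fun ω => ?_)
    simp [sq]
  rw [h2] at h
  linarith

theorem integral_bit (hB : ∀ a, Measurable (B a)) {a : ι} (hp : P.real {ω | B a ω = true} = p)
    (F : Bool → ℝ) : ∫ ω, F (B a ω) ∂P = p * F true + (1 - p) * F false := by
  have hs : MeasurableSet {ω | B a ω = true} := measurableSet_eq_fun (hB a) measurable_const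
  have hf : ∀ ω, F (B a ω) =
      {ω | B a ω = true}.indicator (fun _ => F true - F false) ω + F false := by
    intro ω
    cases h : B a ω <;> simp [Set.indicator, h]
  simp_rw [hf]
  rw [integral_add ((integrable_const _).indicator hs) (integrable_const _),
    integral_indicator hs, setIntegral_const, hp]
  simp
  ring

variable (hB : ∀ a, Measurable (B a)) (hp : ∀ a, P.real {ω | B a ω = true} = p)
  (hind : Pairwise fun a b => IndepFun (B a) (B b) P)
include hB hp hind

theorem integral_bit_mul [DecidableEq ι] (a b : ι) :
    ∫ ω, (bitVal (B a ω) - p) * (bitVal (B b ω) - p) ∂P = if a = b then p * (1 - p) else 0 := by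
  split_ifs with h
  · subst h
    rw [integral_bit hB (hp a) fun β => (bitVal β - p) * (bitVal β - p)]
    simp
    ring
  · have h1 := ((hind h).comp (φ := fun β => bitVal β - p) (ψ := fun β => bitVal β - p)
      measurable_from_top measurable_from_top).integral_mul_eq_mul_integral
      (measurable_from_top.comp (hB a)).aestronglyMeasurable
      (measurable_from_top.comp (hB b)).aestronglyMeasurable
    simp only [Pi.mul_apply, Function.comp_apply] at h1
    rw [h1, integral_bit hB (hp a) fun β => bitVal β - p]
    simp
    ring_nf
    simp

theorem integral_bitSum_mul [DecidableEq ι] (A A' : Finset ι) :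
    ∫ ω, bitSum p B A ω * bitSum p B A' ω ∂P = (A ∩ A').card * (p * (1 - p)) := by
  simp only [bitSum, Finset.sum_mul_sum]
  rw [integral_finsetSum]
  · have : ∀ a ∈ A, ∫ ω, ∑ b ∈ A', (bitVal (B a ω) - p) * (bitVal (B b ω) - p) ∂P =
        ∑ b ∈ A', if a = b then p * (1 - p) else 0 := by
      intro a _
      rw [integral_finsetSum]
      · exact Finset.sum_congr rfl fun b _ => integral_bit_mul hB hp hind a b
      · exact fun b _ => (memLp_bit hB a).integrable_mul (memLp_bit hB b)
    rw [Finset.sum_congr rfl this]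
    simp [Finset.sum_ite_eq]
  · exact fun a _ => integrable_finsetSum _ fun b _ =>
      (memLp_bit hB a).integrable_mul (memLp_bit hB b)

theorem integral_abs_bitSum_le (A : Finset ι) :
    ∫ ω, |bitSum p B A ω| ∂P ≤ √(A.card * (p * (1 - p))) := by
  classical
  refine (integral_abs_le_sqrt (memLp_bitSum hB A)).trans_eq ?_
  rw [integral_bitSum_mul hB hp hind, Finset.inter_self]

/-- Both counts have variance `1`, and pairwise independence makes their covariance `√(|A|/|A'|)`;
the radicand is the second moment of the difference. -/
theorem integral_abs_bitXi_sub_le (hp0 : 0 < p) (hp1 : p < 1) {A A' : Finset ι} (hA : A.Nonempty)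
    (hAA' : A ⊆ A') :
    ∫ ω, |bitXi p B A' ω - bitXi p B A ω| ∂P ≤ √(2 - 2 * √(A.card / A'.card : ℝ)) := by
  classical
  have hs : 0 < p * (1 - p) := mul_pos hp0 (by linarith)
  have hcA : (0 : ℝ) < A.card := by exact_mod_cast hA.card_pos
  have hcA' : (0 : ℝ) < A'.card := by exact_mod_cast (hA.mono hAA').card_pos
  set x := √(A.card * (p * (1 - p))) with hx
  set y := √(A'.card * (p * (1 - p))) with hy
  have hx0 : 0 < x := Real.sqrt_pos.mpr (by positivity)
  have hy0 : 0 < y := Real.sqrt_pos.mpr (by positivity)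
  have hxx : x * x = A.card * (p * (1 - p)) := Real.mul_self_sqrt (by positivity)
  have hyy : y * y = A'.card * (p * (1 - p)) := Real.mul_self_sqrt (by positivity)
  have hxy : √(A.card / A'.card : ℝ) = x / y := by
    rw [hx, hy, ← Real.sqrt_div (by positivity)]
    rw [mul_div_mul_right _ _ hs.ne']
  have hf : MemLp (fun ω => bitXi p B A' ω - bitXi p B A ω) 2 P :=
    (memLp_bitXi hB A').sub (memLp_bitXi hB A)
  refine (integral_abs_le_sqrt hf).trans_eq ?_
  congr 1
  have hexp : ∀ ω, (bitXi p B A' ω - bitXi p B A ω) * (bitXi p B A' ω - bitXi p B A ω) =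
      (y * y)⁻¹ * (bitSum p B A' ω * bitSum p B A' ω) +
      (x * x)⁻¹ * (bitSum p B A ω * bitSum p B A ω) -
      (2 * (x * y)⁻¹) * (bitSum p B A ω * bitSum p B A' ω) := by
    intro ω
    simp only [bitXi, ← hx, ← hy]
    field_simp
    ring
  simp_rw [hexp]
  have hi : ∀ C C' : Finset ι, Integrable (fun ω => bitSum p B C ω * bitSum p B C' ω) P :=
    fun C C' => (memLp_bitSum hB C).integrable_mul (memLp_bitSum hB C')
  have hi2 : Integrable (fun ω => (y * y)⁻¹ * (bitSum p B A' ω * bitSum p B A' ω) +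
      (x * x)⁻¹ * (bitSum p B A ω * bitSum p B A ω)) P :=
    ((hi _ _).const_mul _).add ((hi _ _).const_mul _)
  rw [integral_sub hi2 ((hi _ _).const_mul _), integral_add ((hi _ _).const_mul _) ((hi _ _).const_mul _), integral_const_mul,
    integral_const_mul, integral_const_mul, integral_bitSum_mul hB hp hind,
    integral_bitSum_mul hB hp hind, integral_bitSum_mul hB hp hind, Finset.inter_self,
    Finset.inter_self, Finset.inter_eq_left.mpr hAA', ← hxx, ← hyy, hxy]
  field_simp
  ring

end Bits

/-! ### Estimates for characteristic functions -/

theorem norm_cexp_I_sub_le (a b : ℝ) :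
    ‖Complex.exp (a * Complex.I) - Complex.exp (b * Complex.I)‖ ≤ |a - b| := by
  have h : Complex.exp (a * Complex.I) - Complex.exp (b * Complex.I) =
      Complex.exp (b * Complex.I) * (Complex.exp (Complex.I * (a - b : ℝ)) - 1) := by
    rw [mul_sub, ← Complex.exp_add]
    push_cast
    ring_nf
  rw [h, norm_mul, Complex.norm_exp_ofReal_mul_I, one_mul]
  exact Real.norm_exp_I_mul_ofReal_sub_one_le

theorem norm_charFun_map_sub_le {Ω : Type*} [MeasurableSpace Ω] {P : Measure Ω}
    [IsProbabilityMeasure P] {U U' : Ω → ℝ} (hU : Measurable U) (hU' : Measurable U')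
    (hint : Integrable (fun ω => U ω - U' ω) P) (t : ℝ) :
    ‖charFun (P.map U) t - charFun (P.map U') t‖ ≤ |t| * ∫ ω, |U ω - U' ω| ∂P := by
  rw [charFun_apply_real, charFun_apply_real, integral_map hU.aemeasurable (by fun_prop),
    integral_map hU'.aemeasurable (by fun_prop)]
  have hi : ∀ W : Ω → ℝ, Measurable W →
      Integrable (fun ω => Complex.exp (t * W ω * Complex.I)) P := by
    intro W hW
    refine Integrable.of_bound (C := 1) (by fun_prop) (ae_of_all _ fun ω => ?_)
    rw [← Complex.ofReal_mul, Complex.norm_exp_ofReal_mul_I]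
  rw [← integral_sub (hi U hU) (hi U' hU'), ← integral_const_mul]
  refine norm_integral_le_of_norm_le (hint.abs.const_mul _) (ae_of_all _ fun ω => ?_)
  have := norm_cexp_I_sub_le (t * U ω) (t * U' ω)
  push_cast at this
  rwa [← mul_sub, abs_mul] at this

theorem norm_prod_sub_prod_le_sum {ι : Type*} (A : Finset ι) (z z' : ι → ℂ) (hz : ∀ a, ‖z a‖ ≤ 1)
    (hz' : ∀ a, ‖z' a‖ ≤ 1) :
    ‖∏ a ∈ A, z a - ∏ a ∈ A, z' a‖ ≤ ∑ a ∈ A, ‖z a - z' a‖ := by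
  classical
  induction A using Finset.induction_on with
  | empty => simp
  | insert a A ha ih =>
    rw [Finset.prod_insert ha, Finset.prod_insert ha, Finset.sum_insert ha]
    have h : z a * ∏ x ∈ A, z x - z' a * ∏ x ∈ A, z' x =
        (z a - z' a) * ∏ x ∈ A, z x + z' a * (∏ x ∈ A, z x - ∏ x ∈ A, z' x) := by ring
    rw [h]
    refine (norm_add_le _ _).trans (add_le_add ?_ ?_)
    · rw [norm_mul, norm_prod]
      exact mul_le_of_le_one_right (norm_nonneg _)
        (Finset.prod_le_one (fun _ _ => norm_nonneg _) fun x _ => hz x)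
    · rw [norm_mul]
      exact (mul_le_of_le_one_left (norm_nonneg _) (hz' a)).trans ih

/-- Two laws with the same first two moments have characteristic functions that agree to second
order at `0`. -/
theorem charFun_sub_isLittleO {ν ν' : Measure ℝ} [IsProbabilityMeasure ν] [IsProbabilityMeasure ν']
    (h : MemLp id 2 ν) (h' : MemLp id 2 ν') (h1 : ∫ x, x ∂ν = ∫ x, x ∂ν')
    (h2 : ∫ x, x ^ 2 ∂ν = ∫ x, x ^ 2 ∂ν') :
    (fun t => charFun ν t - charFun ν' t) =o[𝓝 0] fun t => t ^ 2 := by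
  have key : ∀ (w : Measure ℝ) [IsProbabilityMeasure w], MemLp id 2 w →
      (fun t => charFun w t - (1 + ((∫ x, x ∂w : ℝ) : ℂ) * t * Complex.I -
        ((∫ x, x ^ 2 ∂w : ℝ) : ℂ) * t ^ 2 / 2)) =o[𝓝 0] fun t : ℝ => t ^ 2 := by
    intro w _ hw
    have h0 := taylor_isLittleO_univ (x₀ := (0 : ℝ)) (n := 2) (contDiff_charFun (n := 2) (by
      exact_mod_cast hw))
    simp only [sub_zero] at h0
    refine h0.congr_left fun t => ?_
    have h3 := taylorWithinEval_charFun_two_zero (P := w) (X := id) (by fun_prop)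
      (by simpa using hw) t
    rw [Measure.map_id] at h3
    rw [h3]
    simp
  have := (key ν h).sub (key ν' h')
  rw [h1, h2] at this
  simpa using this

/-! ### Asymptotics of the standardized sums -/

section Asymptotics

variable (Q : Measure (ℕ → Bool)) [IsProbabilityMeasure Q] (ν : Bool → Measure ℝ)
  [∀ β, IsProbabilityMeasure (ν β)]

theorem charFun_standardizedSum_mixVar (μ σ : ℝ) (n : ℕ) (t : ℝ) :
    charFun ((mixMeasure Q ν).map (standardizedSum μ σ mixVar n)) t =
      ∫ b, Complex.exp (-(t / (σ * √n) * (n * μ) : ℝ) * Complex.I) *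
        ∏ k ∈ Finset.range n, charFun (ν (b k)) (t / (σ * √n)) ∂Q := by
  have hm : Measurable (standardizedSum μ σ mixVar n) :=
    ((Finset.measurable_fun_sum _ fun k _ => measurable_mixVar k).sub_const _).div_const _
  set s := t / (σ * √n) with hs
  rw [charFun_apply_real, integral_map hm.aemeasurable (by fun_prop), integral_const_mul]
  have h := integral_cexp_sum_mixVar Q ν (fun k : Fin n => (k : ℕ)) Fin.val_injective fun _ => s
  have hprod : ∀ b : ℕ → Bool, ∏ k ∈ Finset.range n, charFun (ν (b k)) s =
      ∏ k : Fin n, charFun (ν (b k)) s := fun b =>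
    Finset.prod_range fun k => charFun (ν (b k)) s
  simp_rw [hprod]
  rw [← h, ← integral_const_mul]
  refine integral_congr_ae (ae_of_all _ fun ω => ?_)
  simp only
  rw [← Complex.exp_add, ← Finset.mul_sum, ← Finset.sum_range fun k => mixVar k ω]
  congr 1
  have : t * standardizedSum μ σ mixVar n ω =
      -(s * (n * μ)) + s * ∑ k ∈ Finset.range n, mixVar k ω := by
    rw [standardizedSum, hs]; ring
  rw [← add_mul, ← Complex.ofReal_mul, this]
  push_cast
  rfl

theorem norm_exp_neg_sub_exp_neg_le {x y : ℝ} (hx : 0 ≤ x) (hy : 0 ≤ y) :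
    ‖Complex.exp (-(x : ℂ)) - Complex.exp (-(y : ℂ))‖ ≤ |x - y| := by
  have key : ∀ a b : ℝ, 0 ≤ a → a ≤ b → |Real.exp (-a) - Real.exp (-b)| ≤ b - a := by
    intro a b ha hab
    rw [abs_of_nonneg (sub_nonneg.mpr (Real.exp_le_exp.mpr (by linarith)))]
    have h1 : Real.exp (-b) = Real.exp (-a) * Real.exp (-(b - a)) := by
      rw [← Real.exp_add]; ring_nf
    have h2 := Real.add_one_le_exp (-(b - a))
    have h3 : Real.exp (-a) ≤ 1 := Real.exp_le_one_iff.mpr (by linarith)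
    have h4 := Real.exp_pos (-a)
    rw [h1]
    nlinarith
  rw [← Complex.ofReal_neg, ← Complex.ofReal_neg, ← Complex.ofReal_exp, ← Complex.ofReal_exp,
    ← Complex.ofReal_sub, Complex.norm_real, Real.norm_eq_abs]
  rcases le_total x y with h | h
  · rw [abs_sub_comm x y, abs_of_nonneg (sub_nonneg.mpr h)]; exact key x y hx h
  · rw [abs_of_nonneg (sub_nonneg.mpr h), abs_sub_comm]; exact key y x hy h

variable {p : ℝ} (hp0 : 0 < p) (hp1 : p < 1) (hp : ∀ k, Q.real {b | b k = true} = p)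
  (hind : Pairwise fun k l => IndepFun (fun b : ℕ → Bool => b k) (fun b => b l) Q)
  (hν : ∀ β, MemLp id 2 (ν β)) {μ κ σ : ℝ}
  (hmean : ∀ β, ∫ x, x ∂(ν β) = μ + κ * (bitVal β - p)) (hσ : 0 < σ)

/-- The Gaussian law with the same mean and variance. -/
noncomputable def gaussianOf (w : Measure ℝ) : Measure ℝ :=
  gaussianReal (∫ x, x ∂w) (Var[id; w]).toNNReal

instance (w : Measure ℝ) : IsProbabilityMeasure (gaussianOf w) := by
  unfold gaussianOf; infer_instance

theorem charFun_gaussianOf (w : Measure ℝ) (s : ℝ) :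
    charFun (gaussianOf w) s =
      Complex.exp (s * (∫ x, x ∂w : ℝ) * Complex.I - (Var[id; w] : ℝ) * s ^ 2 / 2) := by
  rw [gaussianOf, charFun_gaussianReal, Real.coe_toNNReal _ (variance_nonneg _ _)]

theorem charFun_sub_gaussianOf_isLittleO {w : Measure ℝ} [IsProbabilityMeasure w]
    (hw : MemLp id 2 w) :
    (fun t => charFun w t - charFun (gaussianOf w) t) =o[𝓝 0] fun t => t ^ 2 := by
  have hG : MemLp id 2 (gaussianOf w) := memLp_id_gaussianReal 2
  have hmean : ∫ x, x ∂(gaussianOf w) = ∫ x, x ∂w := integral_id_gaussianReal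
  refine charFun_sub_isLittleO hw hG hmean.symm ?_
  have h1 := variance_eq_sub hw
  have h2 := variance_eq_sub hG
  have h3 : Var[id; gaussianOf w] = Var[id; w] := by
    rw [gaussianOf, variance_id_gaussianReal, Real.coe_toNNReal _ (variance_nonneg _ _)]
  simp only [id, Pi.pow_apply] at h1 h2
  rw [hmean, h3, h1] at h2
  linarith

omit [∀ β, IsProbabilityMeasure (ν β)] in
include hp hind hmean in
/-- The product of Gaussian characteristic functions along a bit sequence: the variance part may
be replaced by its average. -/
theorem norm_integral_prod_gaussianOf_sub_le (s : ℝ) (n : ℕ) :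
    ‖∫ b, Complex.exp (-(s * (n * μ) : ℝ) * Complex.I) *
        ∏ k ∈ Finset.range n, charFun (gaussianOf (ν (b k))) s ∂Q -
      (∫ b, Complex.exp ((s * κ * bitSum p (fun k (b : ℕ → Bool) => b k) (Finset.range n) b : ℝ) *
        Complex.I) ∂Q) * Complex.exp (-(s ^ 2 / 2 *
          (n * (p * Var[id; ν true] + (1 - p) * Var[id; ν false])) : ℝ))‖ ≤
      s ^ 2 / 2 * |Var[id; ν true] - Var[id; ν false]| * √(n * (p * (1 - p))) := by
  set v : Bool → ℝ := fun β => Var[id; ν β] with hv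
  set vbar := p * v true + (1 - p) * v false with hvbar
  set T := bitSum p (fun k (b : ℕ → Bool) => b k) (Finset.range n) with hT
  have hB : ∀ k, Measurable fun b : ℕ → Bool => b k := fun k => measurable_pi_apply k
  have hTm : Measurable T := measurable_bitSum hB _
  -- Any function of one bit is affine in it, so the total conditional variance is its average plus
  -- a multiple of the centered count `T`.
  have hvβ : ∀ β, v β = vbar + (v true - v false) * (bitVal β - p) := by
    intro β; cases β <;> simp [hvbar] <;> ring
  have hVT : ∀ b, ∑ k ∈ Finset.range n, v (b k) = n * vbar + (v true - v false) * T b := by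
    intro b
    rw [Finset.sum_congr rfl fun k _ => hvβ (b k), Finset.sum_add_distrib, ← Finset.mul_sum]
    simp [hT, bitSum]
  have hMT : ∀ b : ℕ → Bool, ∑ k ∈ Finset.range n, ∫ x, x ∂(ν (b k)) = n * μ + κ * T b := by
    intro b
    rw [Finset.sum_congr rfl fun k _ => hmean (b k), Finset.sum_add_distrib, ← Finset.mul_sum]
    simp [hT, bitSum]
  have hpt : ∀ b : ℕ → Bool, Complex.exp (-(s * (n * μ) : ℝ) * Complex.I) *
        ∏ k ∈ Finset.range n, charFun (gaussianOf (ν (b k))) s =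
      Complex.exp ((s * κ * T b : ℝ) * Complex.I) *
        Complex.exp (-((s ^ 2 / 2 * ∑ k ∈ Finset.range n, v (b k) : ℝ) : ℂ)) := by
    intro b
    simp_rw [charFun_gaussianOf]
    rw [← Complex.exp_sum, ← Complex.exp_add, ← Complex.exp_add]
    congr 1
    rw [Finset.sum_sub_distrib, ← Finset.sum_mul, ← Finset.mul_sum, ← Finset.sum_div,
      ← Finset.sum_mul]
    have h1 : (∑ k ∈ Finset.range n, ((∫ x, x ∂(ν (b k)) : ℝ) : ℂ)) = ((n * μ + κ * T b : ℝ) : ℂ) := by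
      rw [← hMT b]; push_cast; rfl
    rw [h1]
    push_cast
    ring
  have hnn : ∀ b : ℕ → Bool, 0 ≤ s ^ 2 / 2 * ∑ k ∈ Finset.range n, v (b k) := fun b =>
    mul_nonneg (by positivity) (Finset.sum_nonneg fun k _ => variance_nonneg _ _)
  have hp01 : 0 ≤ p ∧ p ≤ 1 := by
    rw [← hp 0]; exact ⟨measureReal_nonneg, measureReal_le_one⟩
  have hnn' : 0 ≤ s ^ 2 / 2 * (n * vbar) := by
    have h1 : 0 ≤ v true := variance_nonneg _ _
    have h2 : 0 ≤ v false := variance_nonneg _ _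
    have h3 : 0 ≤ 1 - p := by linarith [hp01.2]
    have h4 := hp01.1
    positivity
  have hVm : Measurable fun b : ℕ → Bool => ∑ k ∈ Finset.range n, v (b k) :=
    Finset.measurable_fun_sum _ fun k _ => (measurable_from_top (f := v)).comp (hB k)
  have hi1 : Integrable (fun b => Complex.exp ((s * κ * T b : ℝ) * Complex.I) *
        Complex.exp (-((s ^ 2 / 2 * ∑ k ∈ Finset.range n, v (b k) : ℝ) : ℂ))) Q := by
    refine Integrable.of_bound (C := 1) (by fun_prop) (ae_of_all _ fun b => ?_)
    rw [norm_mul, Complex.norm_exp_ofReal_mul_I, one_mul, ← Complex.ofReal_neg, ← Complex.ofReal_exp,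
      Complex.norm_real, Real.norm_eq_abs, Real.abs_exp]
    exact Real.exp_le_one_iff.mpr (neg_nonpos.mpr (hnn b))
  have hi2 : Integrable (fun b => Complex.exp ((s * κ * T b : ℝ) * Complex.I) *
        Complex.exp (-((s ^ 2 / 2 * (n * vbar) : ℝ) : ℂ))) Q := by
    refine Integrable.mul_const (Integrable.of_bound (C := 1) (by fun_prop)
      (ae_of_all _ fun b => ?_)) _
    rw [Complex.norm_exp_ofReal_mul_I]
  simp_rw [hpt]
  rw [← integral_mul_const, ← integral_sub hi1 hi2]
  have hTi : Integrable T Q := (memLp_bitSum hB _).integrable (by norm_num)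
  calc _ ≤ ∫ b, s ^ 2 / 2 * |v true - v false| * |T b| ∂Q := by
        refine norm_integral_le_of_norm_le (hTi.abs.const_mul _) (ae_of_all _ fun b => ?_)
        rw [← mul_sub, norm_mul, Complex.norm_exp_ofReal_mul_I, one_mul]
        refine (norm_exp_neg_sub_exp_neg_le (hnn b) hnn').trans_eq ?_
        rw [← mul_sub, hVT, add_sub_cancel_left, abs_mul, abs_mul,
          abs_of_nonneg (by positivity : 0 ≤ s ^ 2 / 2)]
        ring
    _ ≤ _ := by
        rw [integral_const_mul]
        -- The count `T` is only of order `√n`; with `s²` of order `1/n` the error is of order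
        -- `1/√n`.
        have := integral_abs_bitSum_le (P := Q) hB hp hind (Finset.range n)
        rw [Finset.card_range] at this
        exact mul_le_mul_of_nonneg_left this (by positivity)

theorem measurable_prod_charFun_bit {w : Bool → Measure ℝ} (s : ℝ) (n : ℕ) :
    Measurable fun b : ℕ → Bool => ∏ k ∈ Finset.range n, charFun (w (b k)) s :=
  Finset.measurable_fun_prod _ fun k _ =>
    (measurable_from_top (f := fun β => charFun (w β) s)).comp (measurable_pi_apply k)

/-- Replacing the components of the mixture by Gaussian laws with the same means and variances. -/
theorem norm_integral_prod_charFun_sub_le (x s : ℝ) (n : ℕ) :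
    ‖∫ b, Complex.exp (-(x : ℝ) * Complex.I) *
        ∏ k ∈ Finset.range n, charFun (ν (b k)) s ∂Q -
      ∫ b, Complex.exp (-(x : ℝ) * Complex.I) *
        ∏ k ∈ Finset.range n, charFun (gaussianOf (ν (b k))) s ∂Q‖ ≤
      n * ‖charFun (ν true) s - charFun (gaussianOf (ν true)) s‖ +
      n * ‖charFun (ν false) s - charFun (gaussianOf (ν false)) s‖ := by
  have hx : ‖Complex.exp (-(x : ℝ) * Complex.I)‖ = 1 := by
    rw [← Complex.ofReal_neg, Complex.norm_exp_ofReal_mul_I]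
  have hi : ∀ w : Bool → Measure ℝ, (∀ β, IsProbabilityMeasure (w β)) →
      Integrable (fun b : ℕ → Bool => Complex.exp (-(x : ℝ) * Complex.I) *
        ∏ k ∈ Finset.range n, charFun (w (b k)) s) Q := by
    intro w hw
    refine (Integrable.of_bound (C := 1) (measurable_prod_charFun_bit s n).aestronglyMeasurable
      (ae_of_all _ fun b => ?_)).const_mul _
    rw [norm_prod]
    exact Finset.prod_le_one (fun _ _ => norm_nonneg _) fun k _ => norm_charFun_le_one _
  rw [← integral_sub (hi _ inferInstance) (hi (fun β => gaussianOf (ν β)) inferInstance)]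
  refine (norm_integral_le_of_norm_le_const (C := n * ‖charFun (ν true) s -
    charFun (gaussianOf (ν true)) s‖ + n * ‖charFun (ν false) s -
    charFun (gaussianOf (ν false)) s‖) (ae_of_all _ fun b => ?_)).trans_eq (by simp)
  rw [← mul_sub, norm_mul, hx, one_mul]
  refine (norm_prod_sub_prod_le_sum _ _ _ (fun _ => norm_charFun_le_one _)
    fun _ => norm_charFun_le_one _).trans ?_
  rw [← mul_add]
  refine (Finset.sum_le_card_nsmul _ _ (‖charFun (ν true) s - charFun (gaussianOf (ν true)) s‖ +
    ‖charFun (ν false) s - charFun (gaussianOf (ν false)) s‖) fun k _ => ?_).trans_eq (by simp [mul_add])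
  cases b k
  · exact le_add_of_nonneg_left (norm_nonneg _)
  · exact le_add_of_nonneg_right (norm_nonneg _)

/-- Each replacement of a component by a Gaussian costs `o(s²) = o(1/n)`, so `n` replacements cost
`o(1)`. -/
theorem tendsto_mul_norm_charFun_sub_gaussianOf {w : Measure ℝ} [IsProbabilityMeasure w]
    (hw : MemLp id 2 w) {σ : ℝ} (hσ : 0 < σ) (t : ℝ) :
    Tendsto (fun n : ℕ => n * ‖charFun w (t / (σ * √n)) - charFun (gaussianOf w) (t / (σ * √n))‖)
      atTop (𝓝 0) := by
  have hs : Tendsto (fun n : ℕ => t / (σ * √n)) atTop (𝓝 0) :=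
    tendsto_const_nhds.div_atTop
      ((Real.tendsto_sqrt_atTop.comp tendsto_natCast_atTop_atTop).const_mul_atTop hσ)
  have h := ((charFun_sub_gaussianOf_isLittleO hw).comp_tendsto hs).norm_left
  have h2 := (Asymptotics.isBigO_refl (fun n : ℕ => (n : ℝ)) atTop).mul_isLittleO h
  have h3 : (fun n : ℕ => (n : ℝ) * ((fun t : ℝ => t ^ 2) ∘ fun n : ℕ => t / (σ * √n)) n)
      =O[atTop] fun _ => (1 : ℝ) := by
    refine Asymptotics.IsBigO.of_bound (t ^ 2 / σ ^ 2) ?_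
    filter_upwards [eventually_gt_atTop 0] with n hn
    have hn' : (0 : ℝ) < n := by exact_mod_cast hn
    have : (n : ℝ) * (t / (σ * √n)) ^ 2 = t ^ 2 / σ ^ 2 := by
      rw [div_pow, mul_pow, Real.sq_sqrt hn'.le]; field_simp
    simp only [Function.comp_apply, this]
    rw [Real.norm_of_nonneg (by positivity)]
    simp
  exact (Asymptotics.isLittleO_one_iff ℝ).mp (h2.trans_isBigO h3)

include hp hind hν hmean hσ hp0 hp1 in
/-- The characteristic function of the standardized sum is asymptotically that of the standardized
number of set bits, convolved with a Gaussian law. -/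
theorem tendsto_charFun_standardizedSum_mixVar (t : ℝ) :
    Tendsto (fun n : ℕ => charFun ((mixMeasure Q ν).map (standardizedSum μ σ mixVar n)) t -
      charFun (Q.map (bitXi p (fun k (b : ℕ → Bool) => b k) (Finset.range n)))
        (κ * √(p * (1 - p)) / σ * t) *
      Complex.exp (-((p * Var[id; ν true] + (1 - p) * Var[id; ν false]) / σ ^ 2 * t ^ 2 / 2 : ℝ)))
      atTop (𝓝 0) := by
  have hpq : 0 < p * (1 - p) := mul_pos hp0 (by linarith)
  have hB : ∀ k, Measurable fun b : ℕ → Bool => b k := fun k => measurable_pi_apply k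
  have hlast : Tendsto (fun n : ℕ => (t / (σ * √n)) ^ 2 / 2 *
      |Var[id; ν true] - Var[id; ν false]| * √(n * (p * (1 - p)))) atTop (𝓝 0) := by
    have h1 : Tendsto (fun n : ℕ => (t ^ 2 / σ ^ 2 / 2 *
        |Var[id; ν true] - Var[id; ν false]| * √(p * (1 - p))) / √n) atTop (𝓝 0) :=
      tendsto_const_nhds.div_atTop (Real.tendsto_sqrt_atTop.comp tendsto_natCast_atTop_atTop)
    refine h1.congr' ?_
    filter_upwards [eventually_gt_atTop 0] with n hn
    have hn' : (0 : ℝ) < √n := Real.sqrt_pos.mpr (by exact_mod_cast hn)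
    have hsq : t / (σ * √n) = t / σ / √n := by rw [div_div]
    have hn2 : √(n : ℝ) ^ 2 = √(n : ℝ) * √n := sq _
    rw [Real.sqrt_mul (Nat.cast_nonneg n) (p * (1 - p)), hsq, div_pow, div_pow t σ, hn2]
    generalize √(p * (1 - p)) = q
    field_simp
  have hbound := ((tendsto_mul_norm_charFun_sub_gaussianOf (hν true) hσ t).add
    (tendsto_mul_norm_charFun_sub_gaussianOf (hν false) hσ t)).add hlast
  simp only [add_zero] at hbound
  refine squeeze_zero_norm' ?_ hbound
  filter_upwards [eventually_gt_atTop 0] with n hn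
  have hn' : (0 : ℝ) < n := by exact_mod_cast hn
  have hn'' : (0 : ℝ) < √n := Real.sqrt_pos.mpr hn'
  set s := t / (σ * √n) with hs
  have h1 := norm_integral_prod_charFun_sub_le Q ν (s * (n * μ)) s n
  have h2 := norm_integral_prod_gaussianOf_sub_le Q ν hp hind hmean s n
  have h3 : charFun (Q.map (bitXi p (fun k (b : ℕ → Bool) => b k) (Finset.range n)))
        (κ * √(p * (1 - p)) / σ * t) =
      ∫ b, Complex.exp ((s * κ * bitSum p (fun k (b : ℕ → Bool) => b k) (Finset.range n) b : ℝ) *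
        Complex.I) ∂Q := by
    rw [charFun_apply_real, integral_map (measurable_bitXi hB _).aemeasurable (by fun_prop)]
    refine integral_congr_ae (ae_of_all _ fun b => ?_)
    have hpq' : 0 < √(p * (1 - p)) := Real.sqrt_pos.mpr hpq
    have : s * κ * bitSum p (fun k (b : ℕ → Bool) => b k) (Finset.range n) b =
        (κ * √(p * (1 - p)) / σ * t) * bitXi p (fun k (b : ℕ → Bool) => b k) (Finset.range n) b := by
      rw [bitXi, Finset.card_range, Real.sqrt_mul hn'.le, hs]
      field_simp
    simp only [this]
    push_cast
    rfl
  have h4 : (p * Var[id; ν true] + (1 - p) * Var[id; ν false]) / σ ^ 2 * t ^ 2 / 2 =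
      s ^ 2 / 2 * (n * (p * Var[id; ν true] + (1 - p) * Var[id; ν false])) := by
    rw [hs, div_pow, mul_pow, Real.sq_sqrt hn'.le]
    field_simp
  rw [charFun_standardizedSum_mixVar, h3, h4, ← Complex.ofReal_neg]
  rw [← Complex.ofReal_neg] at h1 h2
  exact (norm_sub_le_norm_sub_add_norm_sub _ _ _).trans (add_le_add h1 (by simpa using h2))

end Asymptotics

/-! ### From bits to variables with a prescribed law -/

/-- A convolution of a rescaled law with a normal law can be normal only if the law itself is. -/
theorem not_isNormalLaw_conv_gaussianReal {ν : Measure ℝ} [IsProbabilityMeasure ν]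
    (hν : ¬ IsNormalLaw ν) {r : ℝ} (hr : r ≠ 0) (c : NNReal) :
    ¬ IsNormalLaw ((ν.map (r * ·)).conv (gaussianReal 0 c)) := by
  rintro ⟨a, v, h⟩
  have : IsProbabilityMeasure (ν.map (r * ·)) := Measure.isProbabilityMeasure_map (by fun_prop)
  -- The Gaussian factor never vanishes and can be cancelled, leaving the exponential of a
  -- quadratic; Cramér's theorem is not needed.
  have hcf : ∀ t : ℝ, charFun ν (r * t) =
      Complex.exp (t * a * Complex.I - ((v - c : ℝ) : ℂ) * t ^ 2 / 2) := by
    intro t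
    have h1 := congrArg (fun w => charFun w t) h
    simp only [charFun_conv, charFun_map_mul, charFun_gaussianReal] at h1
    have h2 : Complex.exp (t * a * Complex.I - ((v - c : ℝ) : ℂ) * t ^ 2 / 2) *
        Complex.exp (t * ((0 : ℝ) : ℂ) * Complex.I - ((c : ℝ) : ℂ) * t ^ 2 / 2) =
        Complex.exp (t * a * Complex.I - ((v : ℝ) : ℂ) * t ^ 2 / 2) := by
      rw [← Complex.exp_add]
      congr 1
      push_cast
      ring
    rw [← h2] at h1
    exact mul_right_cancel₀ (Complex.exp_ne_zero _) h1
  -- A characteristic function is bounded by `1`; at `t = 1` this gives the sign of the remaining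
  -- variance.
  have hvc : 0 ≤ (v : ℝ) - c := by
    have h1 := norm_charFun_le_one (μ := ν) (r * 1)
    rw [hcf, Complex.norm_exp] at h1
    have h2 := Real.exp_le_one_iff.mp h1
    have h3 : (((1 : ℝ) : ℂ) * a * Complex.I - ((v - c : ℝ) : ℂ) * ((1 : ℝ) : ℂ) ^ 2 / 2).re =
        - ((v - c : ℝ) / 2) := by
      have : ((1 : ℝ) : ℂ) * a * Complex.I - ((v - c : ℝ) : ℂ) * ((1 : ℝ) : ℂ) ^ 2 / 2 =
        ((-((v - c : ℝ) / 2) : ℝ) : ℂ) + (a : ℂ) * Complex.I := by push_cast; ring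
      rw [this, Complex.add_re, Complex.ofReal_re, Complex.re_ofReal_mul, Complex.I_re, mul_zero,
        add_zero]
    rw [h3] at h2
    linarith
  have hd : 0 ≤ ((v : ℝ) - c) / r ^ 2 := by positivity
  set d : NNReal := ⟨((v : ℝ) - c) / r ^ 2, hd⟩ with hdd
  refine hν ⟨a / r, d, Measure.ext_of_charFun (funext fun u => ?_)⟩
  have h1 := hcf (u / r)
  rw [mul_div_cancel₀ _ hr] at h1
  rw [h1, charFun_gaussianReal]
  congr 1
  have hr' : (r : ℂ) ≠ 0 := by exact_mod_cast hr
  rw [show (d : ℝ) = ((v : ℝ) - c) / r ^ 2 from rfl]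
  push_cast
  field_simp

/-- Any two distinct indices belong to the range of an injective `K`-tuple. -/
theorem pairwise_indepFun_of_tuplewise {Ω : Type*} [MeasurableSpace Ω] {P : Measure Ω} {K : ℕ}
    (hK : 2 ≤ K) {B : ℕ → Ω → Bool}
    (hind : ∀ i : Fin K → ℕ, Function.Injective i → iIndepFun (fun j => B (i j)) P) :
    Pairwise fun k l => IndepFun (B k) (B l) P := by
  intro k l hkl
  -- A permutation of `ℕ` sending `0` to `k` and `1` to `l` gives an injective `K`-tuple starting
  -- with `k, l`.
  set e₁ : Equiv.Perm ℕ := Equiv.swap 0 k with he₁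
  set e : Equiv.Perm ℕ := Equiv.swap (e₁ 1) l * e₁ with he
  have h10 : e₁ 0 = k := Equiv.swap_apply_left 0 k
  have h0 : e 0 = k := by
    rw [he, Equiv.Perm.mul_apply, h10]
    refine Equiv.swap_apply_of_ne_of_ne (fun h => ?_) hkl
    rw [← h10] at h
    exact absurd (e₁.injective h) (by norm_num)
  have h1 : e 1 = l := by rw [he, Equiv.Perm.mul_apply, Equiv.swap_apply_left]
  have h := (hind (fun j : Fin K => e j) (e.injective.comp Fin.val_injective)).indepFun
    (i := ⟨0, by omega⟩) (j := ⟨1, by omega⟩) (by simp)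
  simpa [h0, h1] using h

/-- From `K`-tuplewise independent bits with probability `p`, a `K`-tuplewise independent sequence
with a prescribed marginal law whose standardized partial sums have non-normal limits along every
subsequence along which the standardized number of set bits has. -/
theorem exists_tuplewise_of_bits {Ω₁ : Type*} [MeasurableSpace Ω₁] (P₁ : Measure Ω₁)
    [IsProbabilityMeasure P₁] (W : Ω₁ → ℝ) (hW : MemLp W 2 P₁) (μ σ : ℝ)
    (hμ : ∫ ω, W ω ∂P₁ = μ) (hσ : Var[W; P₁] = σ ^ 2) (hσ_pos : 0 < σ)
    {Ω' : Type*} [MeasurableSpace Ω'] (P' : Measure Ω') [IsProbabilityMeasure P']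
    {K : ℕ} (hK : 2 ≤ K) {p : ℝ} (hp0 : 0 < p) (hp1 : p < 1) (B : ℕ → Ω' → Bool)
    (hB : ∀ k, Measurable (B k)) (hp : ∀ k, P'.real {ω | B k ω = true} = p)
    (hind : ∀ i : Fin K → ℕ, Function.Injective i → iIndepFun (fun j => B (i j)) P')
    (ν : Measure ℝ) [IsProbabilityMeasure ν] (hν : ¬ IsNormalLaw ν) :
    ∃ (Ω : Type) (_ : MeasurableSpace Ω) (P : Measure Ω) (_ : IsProbabilityMeasure P)
      (X : ℕ → Ω → ℝ),
      (∀ k, Measurable (X k)) ∧ (∀ k, IdentDistrib (X k) W P P₁) ∧ KTuplewiseIndep K X P ∧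
      ∃ ρ : ProbabilityMeasure ℝ, ¬ IsNormalLaw (ρ : Measure ℝ) ∧
        ∀ φ : ℕ → ℕ, Tendsto φ atTop atTop →
          (∀ t, Tendsto (fun j => charFun (P'.map (bitXi p B (Finset.range (φ j)))) t) atTop
            (𝓝 (charFun ν t))) →
          TendstoInDistribution (fun j => standardizedSum μ σ X (φ j)) atTop (id : ℝ → ℝ)
            (fun _ => P) (ρ : Measure ℝ) := by
  have hWm : AEMeasurable W P₁ := hW.1.aemeasurable
  have : IsProbabilityMeasure (P₁.map W) := Measure.isProbabilityMeasure_map hWm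
  have hvar : Var[id; P₁.map W] = σ ^ 2 := by rw [variance_id_map hWm, hσ]
  obtain ⟨η, hη, hη2, hηw, κ, hκ, hmean⟩ := exists_mixture_decomposition (w := P₁.map W) (μ := μ)
    ((memLp_map_measure_iff (by fun_prop) hWm).mpr hW)
    (by rw [integral_map hWm (by fun_prop)]; exact hμ) (by rw [hvar]; positivity) hp0 hp1
  have hBm : Measurable fun ω k => B k ω := measurable_pi_iff.mpr hB
  -- Only the law of the bits matters. Moving it to `ℕ → Bool` also places the final probability
  -- space in `Type`, whatever the universe of `Ω'`.
  set Q : Measure (ℕ → Bool) := P'.map fun ω k => B k ω with hQ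
  have : IsProbabilityMeasure Q := Measure.isProbabilityMeasure_map hBm.aemeasurable
  have hQp : ∀ k, Q.real {b | b k = true} = p := by
    intro k
    rw [hQ, map_measureReal_apply hBm (measurableSet_eq_fun (measurable_pi_apply k)
      measurable_const), ← hp k]
    rfl
  have hQind : ∀ i : Fin K → ℕ, Function.Injective i →
      iIndepFun (fun j (b : ℕ → Bool) => b (i j)) Q := by
    intro i hi
    have h := hind i hi
    rw [iIndepFun_iff_map_fun_eq_pi_map fun j => (hB _).aemeasurable] at h
    rw [iIndepFun_iff_map_fun_eq_pi_map fun j => (measurable_pi_apply _).aemeasurable, hQ,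
      Measure.map_map (by fun_prop) hBm]
    refine Eq.trans h ?_
    congr 1
    funext j
    rw [Measure.map_map (by fun_prop) hBm]
    rfl
  have hxi : ∀ n t, charFun (Q.map (bitXi p (fun k (b : ℕ → Bool) => b k) (Finset.range n))) t =
      charFun (P'.map (bitXi p B (Finset.range n))) t := by
    intro n t
    rw [hQ, Measure.map_map (measurable_bitXi (fun k => measurable_pi_apply k) _) hBm]
    rfl
  set r := κ * √(p * (1 - p)) / σ with hr
  have hr0 : r ≠ 0 := by
    have : 0 < √(p * (1 - p)) := Real.sqrt_pos.mpr (mul_pos hp0 (by linarith))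
    positivity
  have hc0 : 0 ≤ (p * Var[id; η true] + (1 - p) * Var[id; η false]) / σ ^ 2 := by
    have h1 : 0 ≤ Var[id; η true] := variance_nonneg _ _
    have h2 : 0 ≤ Var[id; η false] := variance_nonneg _ _
    have h3 : 0 ≤ 1 - p := by linarith
    positivity
  set c : NNReal := ⟨_, hc0⟩ with hc
  have hlim := tendsto_charFun_standardizedSum_mixVar Q η hp0 hp1 hQp
    (pairwise_indepFun_of_tuplewise hK hQind) hη2 hmean hσ_pos
  have : IsProbabilityMeasure (ν.map (r * ·)) := Measure.isProbabilityMeasure_map (by fun_prop)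
  have hXm := measurable_mixVar
  set ρ : ProbabilityMeasure ℝ := ⟨(ν.map (r * ·)).conv (gaussianReal 0 c), inferInstance⟩ with hρ
  refine ⟨_, inferInstance, mixMeasure Q η, inferInstance, mixVar, hXm,
    fun k => ⟨(hXm k).aemeasurable, hWm, map_mixVar Q η hQp hηw k⟩,
    kTuplewiseIndep_mixVar Q η hQp hQind,
    ρ, not_isNormalLaw_conv_gaussianReal hν hr0 c, fun φ hφ hconv => ?_⟩
  have hSm : ∀ n, Measurable (standardizedSum μ σ mixVar n) := fun n =>
    ((Finset.measurable_fun_sum _ fun k _ => hXm k).sub_const _).div_const _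
  refine ⟨fun j => (hSm _).aemeasurable, aemeasurable_id, ?_⟩
  refine ProbabilityMeasure.tendsto_iff_tendsto_charFun.mpr fun t => ?_
  simp only [ProbabilityMeasure.coe_mk, Measure.map_id, hρ]
  rw [charFun_conv, charFun_map_mul, charFun_gaussianReal]
  have h1 := (hlim t).comp hφ
  have h2 := h1.add ((hconv (r * t)).mul_const
    (Complex.exp (-((c : ℝ) * t ^ 2 / 2 : ℝ))))
  rw [zero_add] at h2
  have h3 : Complex.exp (t * ((0 : ℝ) : ℂ) * Complex.I - ((c : ℝ) : ℂ) * t ^ 2 / 2) =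
      Complex.exp (-((c : ℝ) * t ^ 2 / 2 : ℝ)) := by
    congr 1
    push_cast
    ring
  rw [h3]
  refine h2.congr fun j => ?_
  simp only [Function.comp_apply, hxi]
  exact sub_add_cancel _ _

/-- If a subsequence converges in law to a non-normal law, the sequence has no normal limit. -/
theorem not_tendstoInDistribution_gaussianReal {Ω : Type*} [MeasurableSpace Ω] {P : Measure Ω}
    [IsProbabilityMeasure P] {S : ℕ → Ω → ℝ} {φ : ℕ → ℕ} (hφ : Tendsto φ atTop atTop)
    {ρ : Measure ℝ} [IsProbabilityMeasure ρ] (hρ : ¬ IsNormalLaw ρ)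
    (h : TendstoInDistribution (fun j => S (φ j)) atTop (id : ℝ → ℝ) (fun _ => P) ρ)
    (a : ℝ) (v : NNReal) :
    ¬ TendstoInDistribution S atTop (id : ℝ → ℝ) (fun _ => P) (gaussianReal a v) := by
  intro hS
  have h' : TendstoInDistribution (fun j => S (φ j)) atTop (id : ℝ → ℝ) (fun _ => P)
      (gaussianReal a v) :=
    ⟨fun j => hS.forall_aemeasurable _, hS.aemeasurable_limit, hS.tendsto.comp hφ⟩
  have := tendstoInDistribution_unique _ h h'
  rw [Measure.map_id, Measure.map_id] at this
  exact hρ ⟨a, v, this⟩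

/-! ### Enumerating edges and comparing index sets -/

/-- An increasing chain of finite sets of unbounded size is enumerated by a sequence whose initial
segments run through the chain. -/
theorem exists_injective_image_range_eq {α : Type*} [DecidableEq α] {F : ℕ → Finset α}
    (hF : Monotone F) (hcard : Tendsto (fun m => (F m).card) atTop atTop) :
    ∃ g : ℕ → α, Function.Injective g ∧ ∀ m, (Finset.range (F m).card).image g = F m := by
  -- Each stage appends only the new elements, so every list is a prefix of the later ones and the
  -- entry at position `k` does not depend on the stage.
  let L : ℕ → List α := fun m =>
    Nat.rec (F 0).toList (fun m l => l ++ (F (m + 1) \ F m).toList) m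
  have hL0 : L 0 = (F 0).toList := rfl
  have hLs : ∀ m, L (m + 1) = L m ++ (F (m + 1) \ F m).toList := fun m => rfl
  have hmem : ∀ m x, x ∈ L m ↔ x ∈ F m := by
    intro m
    induction m with
    | zero => simp [hL0]
    | succ m ih =>
      intro x
      simp only [hLs, List.mem_append, ih, Finset.mem_toList, Finset.mem_sdiff]
      constructor
      · rintro (h | h)
        · exact hF m.le_succ h
        · exact h.1
      · intro h
        by_cases hx : x ∈ F m
        · exact Or.inl hx
        · exact Or.inr ⟨h, hx⟩
  have hnodup : ∀ m, (L m).Nodup := by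
    intro m
    induction m with
    | zero => exact Finset.nodup_toList _
    | succ m ih =>
      rw [hLs]
      refine List.Nodup.append ih (Finset.nodup_toList _) fun x hx hx' => ?_
      exact (Finset.mem_sdiff.mp (Finset.mem_toList.mp hx')).2 ((hmem m x).mp hx)
  have hlen : ∀ m, (L m).length = (F m).card := by
    intro m
    rw [← List.toFinset_card_of_nodup (hnodup m)]
    congr 1
    ext x
    simp [hmem]
  have hpre : ∀ m m', m ≤ m' → L m <+: L m' := by
    intro m m' h
    induction m', h using Nat.le_induction with
    | base => exact List.prefix_rfl
    | succ m' _ ih => exact ih.trans ⟨_, (hLs m').symm⟩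
  have hex : ∀ k, ∃ m, k < (F m).card := fun k =>
    (hcard.eventually_gt_atTop k).exists
  choose M hM using hex
  let g : ℕ → α := fun k => (L (M k))[k]'(by rw [hlen]; exact hM k)
  have hg : ∀ m k (h : k < (L m).length), (L m)[k] = g k := by
    intro m k h
    have hk : k < (L (M k)).length := by rw [hlen]; exact hM k
    rcases le_total m (M k) with h' | h'
    · exact (hpre _ _ h').getElem h
    · exact ((hpre _ _ h').getElem hk).symm
  refine ⟨g, fun k k' hkk => ?_, fun m => ?_⟩
  · obtain ⟨m, hm⟩ := (hcard.eventually_gt_atTop (max k k')).exists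
    have hk : k < (L m).length := by rw [hlen]; exact (le_max_left _ _).trans_lt hm
    have hk' : k' < (L m).length := by rw [hlen]; exact (le_max_right _ _).trans_lt hm
    rw [← hg m k hk, ← hg m k' hk'] at hkk
    exact (hnodup m).getElem_inj_iff.mp hkk
  · ext x
    rw [Finset.mem_image, ← hmem, List.mem_iff_getElem]
    constructor
    · rintro ⟨k, hk, rfl⟩
      have hk' : k < (L m).length := by rw [hlen]; exact Finset.mem_range.mp hk
      exact ⟨k, hk', hg m k hk'⟩
    · rintro ⟨k, hk, rfl⟩
      exact ⟨k, Finset.mem_range.mpr (by rwa [← hlen]), (hg m k hk).symm⟩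

theorem bitXi_comp {ι α Ω : Type*} [DecidableEq α] (p : ℝ) (D : α → Ω → Bool) {g : ι → α}
    (hg : Function.Injective g) (A : Finset ι) :
    bitXi p (fun k => D (g k)) A = bitXi p D (A.image g) := by
  ext ω
  simp only [bitXi, bitSum]
  rw [Finset.sum_image hg.injOn, Finset.card_image_of_injective _ hg]

theorem xiStar_eq_bitXi {V Ω : Type*} {ℓ : ℕ} (G : SimpleGraph V) [Fintype G.edgeSet]
    (M : V → Ω → Fin ℓ) : xiStar G M = bitXi (ℓ : ℝ)⁻¹ (matchBit M) G.edgeFinset := by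
  ext ω
  simp only [xiStar, bitXi, bitSum, edgeMatch_eq_matchBit, bitVal, Finset.sum_sub_distrib,
    Finset.sum_const, nsmul_eq_mul, mul_assoc]

/-- A finite collection of edges already lies in a single stage of the chain. -/
theorem IsLeafy.iUnion_of_monotone {V : Type*} {K : ℕ} {E : ℕ → Set (Sym2 V)} (hE : Monotone E)
    (h : ∀ m, IsLeafy K (E m)) : IsLeafy K (⋃ m, E m) := by
  intro S hS
  have hex : ∀ e ∈ S, ∃ m, e ∈ E m := fun e he => Set.mem_iUnion.mp (hS he)
  choose! f hf using hex
  exact h (S.sup f) S fun e he => hE (Finset.le_sup (f := f) he) (hf e he)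

/-- Enlarging the index sets by a vanishing proportion does not change the limit. -/
theorem tendsto_charFun_bitXi_of_subset {ι Ω : Type*} [MeasurableSpace Ω] {P : Measure Ω}
    [IsProbabilityMeasure P] {p : ℝ} (hp0 : 0 < p) (hp1 : p < 1) {B : ι → Ω → Bool}
    (hB : ∀ a, Measurable (B a)) (hp : ∀ a, P.real {ω | B a ω = true} = p)
    (hind : Pairwise fun a b => IndepFun (B a) (B b) P) {A A' : ℕ → Finset ι}
    (hAA' : ∀ᶠ j in atTop, (A j).Nonempty ∧ A j ⊆ A' j)
    (hcard : Tendsto (fun j => ((A j).card / (A' j).card : ℝ)) atTop (𝓝 1)) {t : ℝ} {z : ℂ}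
    (h : Tendsto (fun j => charFun (P.map (bitXi p B (A j))) t) atTop (𝓝 z)) :
    Tendsto (fun j => charFun (P.map (bitXi p B (A' j))) t) atTop (𝓝 z) := by
  have hlim : Tendsto (fun j => |t| * √(2 - 2 * √((A j).card / (A' j).card : ℝ))) atTop (𝓝 0) := by
    have := (((hcard.sqrt.const_mul 2).const_sub 2).sqrt).const_mul |t|
    simpa using this
  have hd : Tendsto (fun j => charFun (P.map (bitXi p B (A' j))) t -
      charFun (P.map (bitXi p B (A j))) t) atTop (𝓝 0) := by
    refine squeeze_zero_norm' ?_ hlim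
    filter_upwards [hAA'] with j hj
    refine (norm_charFun_map_sub_le (measurable_bitXi hB _) (measurable_bitXi hB _)
      (((memLp_bitXi hB _).sub (memLp_bitXi hB _)).integrable (by norm_num)) t).trans ?_
    exact mul_le_mul_of_nonneg_left
      (integral_abs_bitXi_sub_le hB hp hind hp0 hp1 hj.1 hj.2) (abs_nonneg t)
  simpa using hd.add h

/-! ### Independent copies of the labels -/

section Copies

variable {V Ω : Type*} [MeasurableSpace Ω] (P : Measure Ω) [IsProbabilityMeasure P] {ℓ : ℕ}
  {M : V → Ω → Fin ℓ}

/-- Independent copies, indexed by `ℕ`, of a family of labels. -/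
def labelCopies (M : V → Ω → Fin ℓ) (q : ℕ × V) (ω : ℕ → Ω) : Fin ℓ := M q.2 (ω q.1)

theorem measurable_labelCopies (hM : ∀ i, Measurable (M i)) (q : ℕ × V) :
    Measurable (labelCopies M q) :=
  (hM q.2).comp (measurable_pi_apply q.1)

theorem iIndepFun_labelCopies (hM : ∀ i, Measurable (M i)) (hind : iIndepFun M P) :
    iIndepFun (labelCopies M) (Measure.infinitePi fun _ : ℕ => P) := by
  refine iIndepFun_uncurry' (X := fun i j ω => labelCopies M (i, j) ω)
    (fun i j => measurable_labelCopies hM (i, j)) ?_ fun i => ?_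
  · exact iIndepFun_infinitePi (P := fun _ : ℕ => P) (X := fun _ x j => M j x)
      fun _ => measurable_pi_iff.mpr hM
  · rw [iIndepFun_iff_map_fun_eq_infinitePi_map fun j => measurable_labelCopies hM (i, j)]
    rw [iIndepFun_iff_map_fun_eq_infinitePi_map hM] at hind
    have he := Measure.infinitePi_map_eval (fun _ : ℕ => P) i
    have h1 : ∀ j, (Measure.infinitePi fun _ : ℕ => P).map (fun ω => labelCopies M (i, j) ω) =
        P.map (M j) := by
      intro j
      conv_rhs => rw [← he, Measure.map_map (hM j) (measurable_pi_apply i)]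
      rfl
    simp_rw [h1]
    rw [← hind]
    conv_rhs => rw [← he, Measure.map_map (measurable_pi_iff.mpr hM) (measurable_pi_apply i)]
    rfl

theorem measure_labelCopies (hM : ∀ i, Measurable (M i)) (q : ℕ × V) (a : Fin ℓ) :
    (Measure.infinitePi fun _ : ℕ => P) {ω | labelCopies M q ω = a} = P {ω | M q.2 ω = a} :=
  (measurePreserving_eval_infinitePi (fun _ : ℕ => P) q.1).measure_preimage
    (s := {ω | M q.2 ω = a}) (measurableSet_eq_fun (hM _) measurable_const).nullMeasurableSet

omit [MeasurableSpace Ω] in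
theorem matchBit_labelCopies (j : ℕ) (e : Sym2 V) (ω : ℕ → Ω) :
    matchBit (labelCopies M) (e.map (Prod.mk j)) ω = matchBit M e (ω j) := by
  have h : ω ∈ sameLabel (labelCopies M) (e.map (Prod.mk j)) ↔ ω j ∈ sameLabel M e := by
    induction e with | _ a b
    simp [sameLabel, labelCopies]
  exact decide_eq_decide.mpr h

/-- The `j`-th block only involves the `j`-th coordinate, whose law is `P`; so the block has the law
of the original count. -/
theorem charFun_map_bitXi_copy [DecidableEq (Sym2 (ℕ × V))] (hM : ∀ i, Measurable (M i)) (p : ℝ)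
    (A : Finset (Sym2 V)) (j : ℕ) (t : ℝ) :
    charFun ((Measure.infinitePi fun _ : ℕ => P).map
      (bitXi p (matchBit (labelCopies M)) (A.image (Sym2.map (Prod.mk j))))) t =
      charFun (P.map (bitXi p (matchBit M) A)) t := by
  rw [← bitXi_comp _ _ (Sym2.map.injective (Prod.mk_right_injective j))]
  conv_rhs => rw [← Measure.infinitePi_map_eval (fun _ : ℕ => P) j,
    Measure.map_map (measurable_bitXi (measurable_matchBit hM) _) (measurable_pi_apply j)]
  congr 2
  ext ω
  simp only [bitXi, bitSum, matchBit_labelCopies, Function.comp_apply]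

end Copies

/-! ### Subsequences and bracketing -/

/-- A sequence tending to infinity has a subsequence each of whose terms dominates the sum of the
preceding ones. -/
theorem exists_subseq_dominating {n : ℕ → ℕ} (hn : Tendsto n atTop atTop) :
    ∃ φ : ℕ → ℕ, StrictMono φ ∧ ∀ j, 0 < n (φ j) ∧
      j * ∑ i ∈ Finset.range j, n (φ i) ≤ n (φ j) := by
  obtain ⟨φ, hφ, hr⟩ := exists_seq_of_forall_finset_exists (fun y : ℕ => 0 < n y)
    (fun x y => x < y ∧ (x + 1) * ∑ i ∈ Finset.range (x + 1), n i ≤ n y) fun s _ => by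
      have h1 : ∀ᶠ y in atTop, ∀ x ∈ s,
          x < y ∧ (x + 1) * ∑ i ∈ Finset.range (x + 1), n i ≤ n y :=
        (Filter.eventually_all_finset s).mpr fun x _ =>
          (eventually_gt_atTop x).and (hn.eventually_ge_atTop _)
      exact ((hn.eventually_gt_atTop 0).and h1).exists
  have hmono : StrictMono φ := fun i j hij => (hr i j hij).1
  refine ⟨φ, hmono, fun j => ⟨hφ j, ?_⟩⟩
  cases j with
  | zero => simp
  | succ j =>
    -- Uses `j ≤ φ j`, and that the earlier chosen indices are among `0, …, φ j`.
    refine le_trans (Nat.mul_le_mul (Nat.succ_le_succ (hmono.le_apply (x := j))) ?_)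
      (hr j (j + 1) j.lt_succ_self).2
    rw [← Finset.sum_image (f := n) hmono.injective.injOn]
    refine Finset.sum_le_sum_of_subset fun x hx => ?_
    obtain ⟨i, hi, rfl⟩ := Finset.mem_image.mp hx
    have := Finset.mem_range.mp hi
    exact Finset.mem_range.mpr (Nat.lt_succ_of_le (hmono.monotone (Nat.le_of_lt_succ this)))

/-- Every large number lies between two consecutive terms of a strictly increasing sequence, whose
index tends to infinity. -/
theorem exists_bracketing_index {N : ℕ → ℕ} (hN : StrictMono N) :
    ∃ idx : ℕ → ℕ, Tendsto idx atTop atTop ∧ (∀ᶠ n in atTop, N (idx n) ≤ n) ∧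
      ∀ n, n < N (idx n + 1) := by
  refine ⟨fun n => Nat.findGreatest (fun m => N m ≤ n) n, ?_, ?_, fun n => ?_⟩
  · refine tendsto_atTop.mpr fun b => ?_
    filter_upwards [eventually_ge_atTop (N b)] with n hn
    exact Nat.le_findGreatest (hN.le_apply.trans hn) hn
  · filter_upwards [eventually_ge_atTop (N 0)] with n hn
    exact Nat.findGreatest_spec (P := fun m => N m ≤ n) n.zero_le hn
  · by_contra! h
    have h1 : Nat.findGreatest (fun m => N m ≤ n) n + 1 ≤ n := hN.le_apply.trans h
    exact Nat.findGreatest_is_greatest (Nat.lt_succ_self _) h1 h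

/-! ### The main theorem -/

theorem corollary2
    -- the real random variable `W` with mean `μ` and variance `σ²`, `0 < σ < ∞`
    {Ω₁ : Type*} [MeasurableSpace Ω₁] (P₁ : Measure Ω₁) [IsProbabilityMeasure P₁]
    (W : Ω₁ → ℝ) (hW : MemLp W 2 P₁) (μ σ : ℝ) (hμ : ∫ ω, W ω ∂P₁ = μ)
    (hσ : Var[W; P₁] = σ ^ 2) (hσ_pos : 0 < σ)
    -- the graphs, each with finitely many edges and of girth at least `K + 1`
    (K ℓ : ℕ) (hK : 2 ≤ K) (hℓ : 2 ≤ ℓ)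
    {V : Type*} (G : ℕ → SimpleGraph V) [∀ m, Fintype (G m).edgeSet]
    (hgirth : ∀ m, ((K + 1 : ℕ) : ℕ∞) ≤ (G m).egirth)
    (hcard : Tendsto (fun m => (G m).edgeFinset.card) atTop atTop)
    -- independent labels of the vertices, uniformly distributed over `ℓ` values
    {Ω₀ : Type*} [MeasurableSpace Ω₀] (P₀ : Measure Ω₀) [IsProbabilityMeasure P₀]
    (M : V → Ω₀ → Fin ℓ) (hM : ∀ i, Measurable (M i)) (hM_indep : iIndepFun M P₀)
    (hM_unif : ∀ i a, P₀ {ω | M i ω = a} = (ℓ : ENNReal)⁻¹)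
    -- convergence in law to a distribution which is not normal
    (ν : Measure ℝ) [IsProbabilityMeasure ν] (hν : ¬ IsNormalLaw ν)
    (hξ : TendstoInDistribution (fun m => xiStar (G m) M) atTop (id : ℝ → ℝ)
      (fun _ => P₀) ν) :
    ∃ (Ω : Type) (_ : MeasurableSpace Ω) (P : Measure Ω) (_ : IsProbabilityMeasure P)
      (X : ℕ → Ω → ℝ),
      (∀ k, Measurable (X k)) ∧
      (∀ k, IdentDistrib (X k) W P P₁) ∧
      KTuplewiseIndep K X P ∧
      (∀ (a : ℝ) (v : NNReal),
        ¬ TendstoInDistribution (standardizedSum μ σ X) atTop (id : ℝ → ℝ)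
          (fun _ => P) (gaussianReal a v)) ∧
      ((∀ m, (G m).edgeSet ⊆ (G (m + 1)).edgeSet) →
        StrictMono (fun m => (G m).edgeFinset.card) →
        Tendsto (fun m => ((G (m + 1)).edgeFinset.card : ℝ) / ((G m).edgeFinset.card : ℝ))
          atTop (𝓝 1) →
        ∃ ρ : ProbabilityMeasure ℝ, ¬ IsNormalLaw (ρ : Measure ℝ) ∧
          TendstoInDistribution (standardizedSum μ σ X) atTop (id : ℝ → ℝ)
            (fun _ => P) (ρ : Measure ℝ)) := by
  classical
  have hK1 : 1 ≤ K := by omega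
  have hℓ' : (1 : ℝ) < ℓ := by exact_mod_cast hℓ
  have hp0 : (0 : ℝ) < (ℓ : ℝ)⁻¹ := by positivity
  have hp1 : (ℓ : ℝ)⁻¹ < 1 := inv_lt_one_of_one_lt₀ hℓ'
  have hleafy : ∀ m, IsLeafy K (G m).edgeSet := fun m => SimpleGraph.isLeafy_edgeSet (hgirth m)
  have hcf : ∀ t, Tendsto (fun m => charFun (P₀.map
      (bitXi (ℓ : ℝ)⁻¹ (matchBit M) (G m).edgeFinset)) t) atTop (𝓝 (charFun ν t)) := by
    intro t
    have h := ProbabilityMeasure.tendsto_iff_tendsto_charFun.mp hξ.tendsto t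
    simpa only [ProbabilityMeasure.coe_mk, Measure.map_id, xiStar_eq_bitXi] using h
  -- The same `X` must serve both conclusions, so the construction depends on whether the extra
  -- hypotheses hold; if they fail, the second conclusion is vacuous.
  by_cases hnest : (∀ m, (G m).edgeSet ⊆ (G (m + 1)).edgeSet) ∧
      StrictMono (fun m => (G m).edgeFinset.card) ∧
      Tendsto (fun m => ((G (m + 1)).edgeFinset.card : ℝ) / ((G m).edgeFinset.card : ℝ))
          atTop (𝓝 1)
  · obtain ⟨hsub, hmono, hratio⟩ := hnest
    have hEmono : Monotone fun m => (G m).edgeSet := monotone_nat_of_le_succ hsub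
    have hFmono : Monotone fun m => (G m).edgeFinset := fun m m' h =>
      SimpleGraph.edgeFinset_subset_edgeFinset.mpr
        (SimpleGraph.edgeSet_subset_edgeSet.mp (hEmono h))
    obtain ⟨g, hg, hgF⟩ := exists_injective_image_range_eq hFmono hcard
    have hE := IsLeafy.iUnion_of_monotone hEmono hleafy
    have hgE : ∀ k, g k ∈ ⋃ m, (G m).edgeSet := by
      intro k
      obtain ⟨m, hm⟩ := (hcard.eventually_gt_atTop k).exists
      refine Set.mem_iUnion.mpr ⟨m, SimpleGraph.mem_edgeFinset.mp ?_⟩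
      rw [← hgF m]
      exact Finset.mem_image_of_mem g (Finset.mem_range.mpr hm)
    have hBm : ∀ k, Measurable (matchBit M (g k)) := fun k => measurable_matchBit hM _
    have hBp : ∀ k, P₀.real {ω | matchBit M (g k) ω = true} = (ℓ : ℝ)⁻¹ := fun k =>
      measure_matchBit hM hM_indep hM_unif hK1 hE (hgE k)
    have hBi : ∀ i : Fin K → ℕ, Function.Injective i →
        iIndepFun (fun j => matchBit M (g (i j))) P₀ := fun i hi =>
      iIndepFun_matchBit hM hM_indep hM_unif hK1 hE (fun j => g (i j)) (hg.comp hi)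
        fun j => hgE _
    obtain ⟨Ω, mΩ, P, hP, X, hXm, hXid, hXind, ρ, hρ, hconv⟩ :=
      exists_tuplewise_of_bits P₁ W hW μ σ hμ hσ hσ_pos P₀ hK hp0 hp1 (fun k => matchBit M (g k))
        hBm hBp hBi ν hν
    have hS : TendstoInDistribution (standardizedSum μ σ X) atTop (id : ℝ → ℝ)
        (fun _ => P) (ρ : Measure ℝ) := by
      refine hconv id tendsto_id fun t => ?_
      obtain ⟨idx, hidx, hle, hlt⟩ := exists_bracketing_index hmono
      refine tendsto_charFun_bitXi_of_subset hp0 hp1 hBm hBp (pairwise_indepFun_of_tuplewise hK hBi)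
        (A := fun n => Finset.range (G (idx n)).edgeFinset.card) ?_ ?_ ?_
      · filter_upwards [hle, (hcard.comp hidx).eventually_gt_atTop 0] with n hn hn0
        exact ⟨Finset.nonempty_range_iff.mpr hn0.ne', Finset.range_mono hn⟩
      -- With `n_m ≤ n < n_{m+1}`, the proportion `n_m / n` lies between `n_m / n_{m+1}` and `1`.
      · have h1 := (hratio.comp hidx).inv₀ one_ne_zero
        rw [inv_one] at h1
        refine tendsto_of_tendsto_of_tendsto_of_le_of_le' h1 tendsto_const_nhds ?_ ?_
        · filter_upwards [hle, (hcard.comp hidx).eventually_gt_atTop 0] with n hn hn0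
          simp only [Function.comp_apply, inv_div, Finset.card_range, id]
          have h2 : (0 : ℝ) < n := by exact_mod_cast hn0.trans_le hn
          exact div_le_div_of_nonneg_left (by positivity) h2 (by exact_mod_cast (hlt n).le)
        · filter_upwards [hle] with n hn
          simp only [Finset.card_range, id]
          exact div_le_one_of_le₀ (by exact_mod_cast hn) (by positivity)
      · refine ((hcf t).comp hidx).congr fun n => ?_
        rw [bitXi_comp _ _ hg, hgF]
        rfl
    exact ⟨Ω, mΩ, P, hP, X, hXm, hXid, hXind,
      not_tendstoInDistribution_gaussianReal tendsto_id hρ hS, fun _ _ _ => ⟨ρ, hρ, hS⟩⟩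
  · obtain ⟨φ, hφ, hdom⟩ := exists_subseq_dominating hcard
    set P' := Measure.infinitePi fun _ : ℕ => P₀ with hP'
    set M' := labelCopies M with hM'
    set blk : ℕ → Finset (Sym2 (ℕ × V)) := fun j =>
      (G (φ j)).edgeFinset.image (Sym2.map (Prod.mk j)) with hblk
    set F : ℕ → Finset (Sym2 (ℕ × V)) := fun j => (Finset.range (j + 1)).biUnion blk with hF
    have hblkcard : ∀ j, (blk j).card = (G (φ j)).edgeFinset.card := fun j =>
      Finset.card_image_of_injective _ (Sym2.map.injective (Prod.mk_right_injective j))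
    have hblkF : ∀ j, blk j ⊆ F j := fun j =>
      Finset.subset_biUnion_of_mem blk (Finset.mem_range.mpr j.lt_succ_self)
    have hFmono : Monotone F := fun j j' h =>
      Finset.biUnion_subset_biUnion_of_subset_left _ (Finset.range_mono (by omega))
    have hFcard : Tendsto (fun j => (F j).card) atTop atTop := by
      refine tendsto_atTop_mono (fun j => ?_) (hcard.comp hφ.tendsto_atTop)
      simpa [hblkcard] using Finset.card_le_card (hblkF j)
    -- The last block makes up at least the fraction `j / (j + 1)` of all edges used so far, since
    -- `j` times the earlier total is at most its size.
    have hFle : ∀ j, j * (F j).card ≤ (j + 1) * (blk j).card := by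
      intro j
      have h1 : (F j).card ≤ ∑ i ∈ Finset.range j, (G (φ i)).edgeFinset.card + (blk j).card := by
        refine Finset.card_biUnion_le.trans_eq ?_
        rw [Finset.sum_range_succ]
        simp only [hblkcard]
      have h2 := (hdom j).2
      rw [← hblkcard] at h2
      calc j * (F j).card ≤ j * (∑ i ∈ Finset.range j, (G (φ i)).edgeFinset.card + (blk j).card) :=
            Nat.mul_le_mul_left _ h1
        _ ≤ _ := by rw [mul_add, add_mul, one_mul, add_comm]; omega
    obtain ⟨g, hg, hgF⟩ := exists_injective_image_range_eq hFmono hFcard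
    have hE := IsLeafy.iUnion_copies fun j => hleafy (φ j)
    have hgE : ∀ k, g k ∈ ⋃ j, Sym2.map (Prod.mk j) '' (G (φ j)).edgeSet := by
      intro k
      obtain ⟨m, hm⟩ := (hFcard.eventually_gt_atTop k).exists
      have h1 : g k ∈ F m := by
        rw [← hgF m]
        exact Finset.mem_image_of_mem g (Finset.mem_range.mpr hm)
      obtain ⟨j, -, hj⟩ := Finset.mem_biUnion.mp h1
      obtain ⟨e, he, hek⟩ := Finset.mem_image.mp hj
      exact Set.mem_iUnion.mpr ⟨j, e, SimpleGraph.mem_edgeFinset.mp he, hek⟩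
    have hM'm := measurable_labelCopies hM
    have hM'i := iIndepFun_labelCopies P₀ hM hM_indep
    have hM'u : ∀ q a, P' {ω | M' q ω = a} = (ℓ : ENNReal)⁻¹ := fun q a =>
      (measure_labelCopies P₀ hM q a).trans (hM_unif _ _)
    have hBm : ∀ k, Measurable (matchBit M' (g k)) := fun k => measurable_matchBit hM'm _
    have hBp : ∀ k, P'.real {ω | matchBit M' (g k) ω = true} = (ℓ : ℝ)⁻¹ := fun k =>
      measure_matchBit hM'm hM'i hM'u hK1 hE (hgE k)
    have hBi : ∀ i : Fin K → ℕ, Function.Injective i →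
        iIndepFun (fun j => matchBit M' (g (i j))) P' := fun i hi =>
      iIndepFun_matchBit hM'm hM'i hM'u hK1 hE (fun j => g (i j)) (hg.comp hi) fun j => hgE _
    obtain ⟨Ω, mΩ, P, hP, X, hXm, hXid, hXind, ρ, hρ, hconv⟩ :=
      exists_tuplewise_of_bits P₁ W hW μ σ hμ hσ hσ_pos P' hK hp0 hp1 (fun k => matchBit M' (g k))
        hBm hBp hBi ν hν
    have hS : TendstoInDistribution (fun j => standardizedSum μ σ X (F j).card) atTop
        (id : ℝ → ℝ) (fun _ => P) (ρ : Measure ℝ) := by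
      refine hconv _ hFcard fun t => ?_
      -- The positions of the `j`-th block in the enumeration. The bit count over them has the law
      -- of the count for `G (φ j)`, and the rest of the initial segment is negligible.
      set A : ℕ → Finset ℕ := fun j => {k ∈ Finset.range (F j).card | g k ∈ blk j} with hA
      have hAblk : ∀ j, (A j).image g = blk j := by
        intro j
        ext e
        simp only [hA, Finset.mem_image, Finset.mem_filter]
        constructor
        · rintro ⟨k, ⟨-, hk⟩, rfl⟩; exact hk
        · intro he
          have := hblkF j he
          rw [← hgF j] at this
          obtain ⟨k, hk, rfl⟩ := Finset.mem_image.mp this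
          exact ⟨k, ⟨hk, he⟩, rfl⟩
      have hAcard : ∀ j, (A j).card = (blk j).card := by
        intro j
        rw [← hAblk, Finset.card_image_of_injective _ hg]
      have hblkpos : ∀ j, 0 < (blk j).card := fun j => by rw [hblkcard]; exact (hdom j).1
      refine tendsto_charFun_bitXi_of_subset hp0 hp1 hBm hBp (pairwise_indepFun_of_tuplewise hK hBi)
        (A := A) (Eventually.of_forall fun j => ⟨?_, Finset.filter_subset _ _⟩) ?_ ?_
      · exact Finset.card_pos.mp (by rw [hAcard]; exact hblkpos j)
      · refine tendsto_of_tendsto_of_tendsto_of_le_of_le (g := fun j : ℕ => (j / (j + 1) : ℝ))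
          (h := fun _ => 1) (tendsto_natCast_div_add_atTop 1) tendsto_const_nhds
          (fun j => ?_) fun j => ?_
        · have hFpos : (0 : ℝ) < (F j).card := by
            exact_mod_cast (hblkpos j).trans_le (Finset.card_le_card (hblkF j))
          simp only [Finset.card_range, hAcard]
          rw [div_le_div_iff₀ (by positivity) hFpos]
          have := hFle j
          rw [mul_comm (j + 1)] at this
          exact_mod_cast this
        · refine div_le_one_of_le₀ ?_ (by positivity)
          have : A j ⊆ Finset.range (F j).card := Finset.filter_subset _ _
          exact Nat.cast_le.mpr (Finset.card_le_card this)
      · have h1 := (hcf t).comp hφ.tendsto_atTop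
        refine h1.congr fun j => ?_
        rw [bitXi_comp _ _ hg, hAblk]
        exact (charFun_map_bitXi_copy P₀ hM _ _ j t).symm
    exact ⟨Ω, mΩ, P, hP, X, hXm, hXid, hXind,
      not_tendstoInDistribution_gaussianReal hFcard hρ hS,
      fun h1 h2 h3 => absurd ⟨h1, h2, h3⟩ hnest⟩
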